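/- **Setting.** Expanding LRS Bianchi type VIII cosmologies are described by the dominant-normalised Hubble scalar, shear and curvature variables $(H_D,\Sigma_+,M_1)$ with $H_D>1$, $\Sigma_+\in(-1,1)$, $0<M_1<\sqrt{12(1-\Sigma_+^2)}$. The Einstein equations with matter whose energy density $\rho$, pressures $p_i=w_i\rho$ and isotropic pressure $p=w\rho$ satisfy $w=(w_1+2w_2)/3$, $w\in(-\tfrac13,1)$, and $w_2=w_2(s)$, reduce to $$H_D'=-(1-H_D^2)(q-H_D\Sigma_+),$$ $$\Sigma_+'=-(2-q)H_D\Sigma_+-(1-H_D^2)(1-\Sigma_+^2)+\tfrac{M_1^2}{3}+3\Omega\,(w_2(s)-w),$$ $$M_1'=M_1\left(qH_D-4\Sigma_++(1-H_D^2)\Sigma_+\right),$$ where $\Omega=1-\Sigma_+^2-\frac{M_1^2}{12}$, $q=2\Sigma_+^2+\frac{1+3w}{2}\Omega$, $s=\left(2-3\frac{1-H_D^2}{M_1^2}\right)^{-1}\in(0,\tfrac12)$. The function $w_2$ is $C^1$ on $[0,\frac12]$ and satisfies $w_1(\frac12)=w_2(0)$; the anisotropy parameter is $\beta=2\frac{w-w_2(0)}{1-w}$.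 Perfect fluids are $w_2\equiv w$ (so $\beta=0$); vacuum is $\Omega=0$, i.e. $M_1=\sqrt{12(1-\Sigma_+^2)}$. Limits are taken, as rescaled time tends to $+\infty$, in the coordinates $(r,\theta,\Sigma_+)$ defined by $1-H_D^2=2r\cos\theta$, $M_1^2=3r\sin\theta$, $r>0$, $\theta\in(\frac\pi2,\pi)$. "The solution with a given initial state tends to a point" includes that it exists for all future time. "Generic" means: for all initial states in an open dense subset of the state space whose complement in the state space has Lebesgue measure zero. On $\theta=\pi$ (that is, $M_1=0$, $r=(H_D^2-1)/2$) let, in terms of $(H_D,\Sigma_+)$, $$D=(2,1),\qquad R_\flat=(1,-\beta),\qquad P=P(w,\beta)=\left(\tfrac{2+3\beta(1-w)}{\sqrt{(1-3w)^2+6\beta(1-w)}},\ \tfrac{1+3w}{\sqrt{(1-3w)^2+6\beta(1-w)}}\right);$$ $R_\flat$, which lies on $r=0$, represents a type I solution with anisotropic matter. Let $\mathbb P_\supset$ be the set of $(w,\beta)$ with $-\tfrac13<w<\tfrac{1-\sqrt3}{3}$ and $\beta_-(w)<\beta<\beta_+(w)$, where $\beta_\pm(w)=\frac{-1\pm\sqrt{-3+(1-3w)^2}}{3(1-w)}$.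 **Statement.** The future asymptotics of generic LRS Bianchi type VIII cosmologies with anisotropic matter can differ from that of the vacuum and perfect fluid cases: 1. Every vacuum solution tends to $D$. Generic perfect fluid solutions tend to $P(w,0)$ if $w\in(-\frac13,0)$, and to $D$ if $w\in[0,1)$. 2. The region $\mathbb P_\supset$ is non-empty, and for each $(w,\beta)\in\mathbb P_\supset$ there is a matter model with these parameters. For every $(w,\beta)\in\mathbb P_\supset$ and every matter model with these parameters, generic solutions tend to $R_\flat$, and neither to $D$ nor to $P(w,\beta)$ nor to $P(w,0)$. -/

import Mathlib

open Set Filter Topology MeasureTheory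

namespace LRSVIII

noncomputable section

/-- Coordinates `(H_D, Σ₊, M₁)`: the dominant-normalised Hubble scalar, shear and curvature
variables. -/
abbrev XCoord : Type := ℝ × ℝ × ℝ

/-- Blown-up coordinates `(r, θ, Σ₊)`. -/
abbrev YCoord : Type := ℝ × ℝ × ℝ

/-! ### The anisotropic matter family -/

/-- The parameter space `(-1/3, 1) × ℝ` of pairs `(w, β)`. -/
def paramSpace : Set (ℝ × ℝ) := {p | -1 / 3 < p.1 ∧ p.1 < 1}

/-- The rescaled pressure `w₁ = p₁/ρ`, determined by `w = (w₁ + 2 w₂) / 3`. -/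
def w₁ (w : ℝ) (w₂ : ℝ → ℝ) (s : ℝ) : ℝ := 3 * w - 2 * w₂ s

/-- `w₂` is the rescaled pressure function (the anisotropy function), in its dependence on
`s ∈ [0, 1/2]`, of a matter model with parameters `(w, β)`. -/
structure IsMatterModel (w β : ℝ) (w₂ : ℝ → ℝ) : Prop where
  mem_paramSpace : (w, β) ∈ paramSpace
  regular : ContDiffOn ℝ 1 w₂ (Icc 0 (1 / 2))
  endpoints : w₁ w w₂ (1 / 2) = w₂ 0
  anisotropy : β = 2 * (w - w₂ 0) / (1 - w)

/-- The perfect fluid `p₁ = p₂ = p = w ρ`. -/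
def perfectFluid (w : ℝ) : ℝ → ℝ := fun _ => w

/-! ### The dynamical system -/

/-- The normalised energy density, from the Hamiltonian constraint. -/
def Omega (x : XCoord) : ℝ := 1 - x.2.1 ^ 2 - x.2.2 ^ 2 / 12

/-- The deceleration parameter. -/
def decel (w : ℝ) (x : XCoord) : ℝ := 2 * x.2.1 ^ 2 + (1 + 3 * w) / 2 * Omega x

/-- `s = g²² / ∑ᵢ gⁱⁱ` as a function of `H_D` and `M₁` (used only where `M₁ > 0`). -/
def sOf (x : XCoord) : ℝ := (2 - 3 * ((1 - x.1 ^ 2) / x.2.2 ^ 2))⁻¹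

/-- The right-hand side of the reduced Einstein equations in the variables `(H_D, Σ₊, M₁)`. -/
def field (w : ℝ) (w₂ : ℝ → ℝ) (x : XCoord) : XCoord :=
  let H := x.1
  let S := x.2.1
  let M := x.2.2
  let q := decel w x
  (-(1 - H ^ 2) * (q - H * S),
   -(2 - q) * H * S - (1 - H ^ 2) * (1 - S ^ 2) + M ^ 2 / 3 + 3 * Omega x * (w₂ (sOf x) - w),
   M * (q * H - 4 * S + (1 - H ^ 2) * S))

/-- The coordinate transformation `1 - H_D² = 2 r cos θ`, `M₁² = 3 r sin θ`, `Σ₊` unchanged,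
solved for the (positive) `H_D` and the (nonnegative) `M₁`. -/
def toX (y : YCoord) : XCoord :=
  (Real.sqrt (1 - 2 * y.1 * Real.cos y.2.1), y.2.2, Real.sqrt (3 * y.1 * Real.sin y.2.1))

/-- The state space of expanding matter-filled LRS Bianchi type VIII models, in blown-up
coordinates. -/
def stateSpace : Set YCoord :=
  {y | (0 < y.1 ∧ y.1 < 4 * (1 - y.2.2 ^ 2) / Real.sin y.2.1) ∧
    (Real.pi / 2 < y.2.1 ∧ y.2.1 < Real.pi) ∧ (-1 < y.2.2 ∧ y.2.2 < 1)}

/-- The vacuum boundary `Ω = 0` of the state space, in blown-up coordinates. -/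
def vacuumSpace : Set YCoord :=
  {y | y.1 = 4 * (1 - y.2.2 ^ 2) / Real.sin y.2.1 ∧
    (Real.pi / 2 < y.2.1 ∧ y.2.1 < Real.pi) ∧ (-1 < y.2.2 ∧ y.2.2 < 1)}

/-- `γ` is a solution in the set `𝒮`, for all rescaled times `τ ≥ 0`, with initial state `y₀`. -/
structure IsSolution (w : ℝ) (w₂ : ℝ → ℝ) (𝒮 : Set YCoord) (y₀ : YCoord) (γ : ℝ → YCoord) :
    Prop where
  initial : γ 0 = y₀
  mem : ∀ τ, 0 ≤ τ → γ τ ∈ 𝒮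
  ode : IsIntegralCurveOn (fun τ => toX (γ τ)) (fun _ => field w w₂) (Ici 0)

/-- The solution in `𝒮` with initial state `y₀` exists for all future time and is future
asymptotic to the point `p` (of the closure of `𝒮`). -/
def FutureAsymptotic (w : ℝ) (w₂ : ℝ → ℝ) (𝒮 : Set YCoord) (y₀ p : YCoord) : Prop :=
  (∃ γ, IsSolution w w₂ 𝒮 y₀ γ) ∧ ∀ γ, IsSolution w w₂ 𝒮 y₀ γ → Tendsto γ atTop (𝓝 p)

/-- `Q` holds for generic initial states: on an open dense subset of the state space whose
complement in the state space is a Lebesgue null set. -/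
def Generically (Q : YCoord → Prop) : Prop :=
  ∃ U : Set YCoord, U ⊆ stateSpace ∧ IsOpen U ∧ stateSpace ⊆ closure U ∧
    volume (stateSpace \ U) = 0 ∧ ∀ y ∈ U, Q y

/-! ### Fixed points -/

/-- The point with `M₁ = 0` (that is, `θ = π`) and the given values of `H_D ≥ 1` and `Σ₊`:
there `H_D² - 1 = 2 r`. -/
def typeIIIPoint (H S : ℝ) : YCoord := ((H ^ 2 - 1) / 2, Real.pi, S)

/-- `D = [2, 1]`: the type III form of flat spacetime. -/
def D : YCoord := typeIIIPoint 2 1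

/-- `P`: the generalisation of the Collins type VI₋₁ solution. -/
def P (w β : ℝ) : YCoord :=
  typeIIIPoint
    ((2 + 3 * β * (1 - w)) / Real.sqrt ((1 - 3 * w) ^ 2 + 6 * β * (1 - w)))
    ((1 + 3 * w) / Real.sqrt ((1 - 3 * w) ^ 2 + 6 * β * (1 - w)))

/-- `R♭ = [1, -β]`: a type I solution (`r = 0`) with anisotropic matter. -/
def Rflat (β : ℝ) : YCoord := typeIIIPoint 1 (-β)

/-! ### The `⊃`-shaped parameter region -/

def betaMinus (w : ℝ) : ℝ := (-1 - Real.sqrt (-3 + (1 - 3 * w) ^ 2)) / (3 * (1 - w))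

def betaPlus (w : ℝ) : ℝ := (-1 + Real.sqrt (-3 + (1 - 3 * w) ^ 2)) / (3 * (1 - w))

/-- The region between the curves `β₋` and `β₊`, which meet at the tip `w = (1 - √3) / 3`. -/
def paramSup : Set (ℝ × ℝ) :=
  {p | p ∈ paramSpace ∧ p.1 < (1 - Real.sqrt 3) / 3 ∧ betaMinus p.1 < p.2 ∧ p.2 < betaPlus p.1}

end

end LRSVIII

/-!
The conclusions hold for every initial state, not only for generic ones. The variables are written
`H = H_D`, `S = Σ₊`, `M = M₁`; a solution of the equations with `Ω ≥ 0` and the shear source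
`κ = w₂(s) - w` regarded as a given bounded function of time is an `IsOrbit`.

**Existence.** By `exists_isIntegralCurveOn_Ici` it is enough to confine the solutions over bounded
time intervals to compact sets. The point is that `log (H / (1 + S))` grows at most linearly
(`IsOrbit.log_sub_log_rate_le`), which bounds `H`; the other bounds follow from it
(`exists_mem_box`). In the vacuum case, `Ω = 0` is preserved because `Ω'` is a multiple of `Ω`.

**The limit `s → 0`.** The function `(1 - H⁻²)³ (H² - 1) / M²` has logarithmic derivative
`6 q / H ≥ 0`. Adding suitable multiples of the bounded functions `S / H²` and `S / H³` to its
logarithm makes the derivative uniformly positive, so `M² / (H² - 1)` decays exponentially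
(`IsOrbit.exists_sq_div_le`). Since `s ≤ M² / (H² - 1)`, the matter model enters the asymptotics
only through `w₂(0)`, that is, through `β`, with an error that is integrable in time. Moreover
`θ → π`, and `M → 0` as soon as `H` is bounded, so only the limits of `H` and `S` remain to be
found.

**The limits of `H` and `S`.** In each case there is a monotone function
`(H² - 1)^α Ω^γ / (H - v S)^(2 (α + γ))` whose logarithmic derivative is at least a multiple of
`(S - v H)²`, up to an integrable error. If it is bounded, Barbalat's lemma
(`tendsto_zero_of_le_deriv`) gives `S - v H → 0`, and the `H`-equation becomes autonomous in the
limit.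
* For vacuum and for `w ≥ 0`, take `α = 1`, `γ = 0`, `v = 1/2`; the limit is `(2, 1)`
  (`IsOrbit.tendsto_of_nonneg`).
* For a perfect fluid with `w < 0`, take `v = ν = (1 + 3 w) / 2`, `α = ν (2 - ν)`, `γ = 1 - 2 ν`;
  the limit is `(1, ν) / (1 - ν)`, which is `P w 0` (`IsOrbit.tendsto_of_neg`).
* For anisotropic matter in the `⊃`-shaped region, take `α = -1`, with `v` and `γ` from
  `exists_exponents`. Whether this function is bounded or not, `H² - 1 → 0`: if it is unbounded,
  only the factor `(H² - 1)⁻¹` can be responsible; if it is bounded, then `S - v H → 0`, where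
  `q < H S` and hence `H² - 1` decreases. On `H = 1` the remaining equation
  `S' = -a (1 - S²) (S + β)`, where `a = 3 (1 - w) / 2`, drives `S` to `-β`
  (`IsOrbit.tendsto_of_anisotropic`).

In the last case, uniqueness of limits excludes the points `D` and `P`, which do not lie on
`r = 0`.
-/

namespace LRSVIII

/-! ### Continuation of solutions of ordinary differential equations -/

/-- Near a compact subset of its domain, a `C¹` vector field agrees with a bounded, globally
Lipschitz one. -/
theorem exists_lipschitz_cutoff {E : Type*} [NormedAddCommGroup E] [NormedSpace ℝ E]
    [FiniteDimensional ℝ E] {U K : Set E} (hU : IsOpen U) (hK : IsCompact K) (hKU : K ⊆ U)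
    {v : E → E} (hv : ContDiffOn ℝ 1 v U) :
    ∃ (g : E → E) (C L : NNReal) (V : Set E), LipschitzWith C g ∧ (∀ x, ‖g x‖ ≤ L) ∧
      IsOpen V ∧ K ⊆ V ∧ V ⊆ U ∧ EqOn g v V := by
  obtain ⟨K', hK', hKK', hK'U⟩ := exists_compact_between hK hU hKU
  obtain ⟨f, hf1, hf0, -⟩ := exists_contMDiffMap_one_nhds_of_subset_interior (n := 1)
    (modelWithCornersSelf ℝ E) hK.isClosed hKK'
  have hfs : ContDiff ℝ 1 (fun x => f x) := f.contMDiff.contDiff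
  have hsupp : tsupport (fun x => f x) ⊆ K' := by
    refine closure_minimal (fun x hx => ?_) hK'.isClosed
    by_contra h
    exact hx (hf0 x h)
  have hcs : HasCompactSupport (fun x => f x) := hK'.of_isClosed_subset (isClosed_tsupport _) hsupp
  have hg : ContDiff ℝ 1 (fun x => f x • v x) := by
    rw [contDiff_iff_contDiffAt]
    intro x
    by_cases hx : x ∈ U
    · exact hfs.contDiffAt.smul (hv.contDiffAt (hU.mem_nhds hx))
    · have hx' : x ∉ tsupport (fun x => f x) := fun h => hx (hK'U (hsupp h))
      have : (fun x => f x • v x) =ᶠ[𝓝 x] fun _ => 0 := by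
        filter_upwards [(isClosed_tsupport _).isOpen_compl.mem_nhds hx'] with y hy
        rw [image_eq_zero_of_notMem_tsupport hy, zero_smul]
      exact contDiffAt_const.congr_of_eventuallyEq this
  have hgc : HasCompactSupport (fun x => f x • v x) := hcs.smul_right
  obtain ⟨C, hC⟩ := hg.lipschitzWith_of_hasCompactSupport hgc one_ne_zero
  obtain ⟨L, hL⟩ := hgc.exists_bound_of_continuous hg.continuous
  rw [Filter.eventually_iff, mem_nhdsSet_iff_exists] at hf1
  obtain ⟨V, hV, hKV, hV1⟩ := hf1
  refine ⟨_, C, L.toNNReal, V ∩ interior K', hC, fun x => (hL x).trans (Real.le_coe_toNNReal L),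
    hV.inter isOpen_interior, subset_inter hKV hKK', fun x hx => hK'U (interior_subset hx.2), ?_⟩
  intro x hx
  have : f x = 1 := hV1 hx.1
  simp [this]

theorem eqOn_of_isIntegralCurve {E : Type*} [NormedAddCommGroup E] [NormedSpace ℝ E]
    [FiniteDimensional ℝ E] {U : Set E} (hU : IsOpen U)
    {v : E → E} (hv : ContDiffOn ℝ 1 v U) {T : ℝ} {x y : ℝ → E}
    (hx : ∀ t ∈ Icc 0 T, HasDerivWithinAt x (v (x t)) (Icc 0 T) t) (hxU : ∀ t ∈ Icc 0 T, x t ∈ U)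
    (hy : ∀ t ∈ Icc 0 T, HasDerivWithinAt y (v (y t)) (Icc 0 T) t) (hyU : ∀ t ∈ Icc 0 T, y t ∈ U)
    (h0 : x 0 = y 0) : EqOn x y (Icc 0 T) := by
  have hxc : ContinuousOn x (Icc 0 T) := fun t ht => (hx t ht).continuousWithinAt
  have hyc : ContinuousOn y (Icc 0 T) := fun t ht => (hy t ht).continuousWithinAt
  obtain ⟨g, C, L, V, hg, -, -, hKV, -, hgv⟩ := exists_lipschitz_cutoff hU
    ((isCompact_Icc.image_of_continuousOn hxc).union (isCompact_Icc.image_of_continuousOn hyc))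
    (union_subset (image_subset_iff.2 hxU) (image_subset_iff.2 hyU)) hv
  have hIci : ∀ t ∈ Ico (0 : ℝ) T, Icc 0 T ∈ 𝓝[Ici t] t := fun t ht =>
    mem_of_superset (Icc_mem_nhdsGE ht.2) (Icc_subset_Icc_left ht.1)
  refine ODE_solution_unique (v := fun _ => g) (K := C) (fun _ => hg) hxc (fun t ht => ?_) hyc
    (fun t ht => ?_) h0
  · rw [hgv (hKV (Or.inl (mem_image_of_mem x (Ico_subset_Icc_self ht))))]
    exact (hx t (Ico_subset_Icc_self ht)).mono_of_mem_nhdsWithin (hIci t ht)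
  · rw [hgv (hKV (Or.inr (mem_image_of_mem y (Ico_subset_Icc_self ht))))]
    exact (hy t (Ico_subset_Icc_self ht)).mono_of_mem_nhdsWithin (hIci t ht)

/-- A solution exists on `[0, T]` if every solution on a shorter interval `[0, t]` ends in the fixed
compact subset `K`. -/
theorem exists_isIntegralCurveOn_Icc {E : Type*} [NormedAddCommGroup E] [NormedSpace ℝ E]
    [FiniteDimensional ℝ E] {U : Set E} (hU : IsOpen U)
    {v : E → E} (hv : ContDiffOn ℝ 1 v U) {x₀ : E} {T : ℝ} (hT : 0 ≤ T) {K : Set E}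
    (hK : IsCompact K) (hKU : K ⊆ U) (hx₀U : x₀ ∈ U)
    (hap : ∀ t ∈ Icc 0 T, ∀ x : ℝ → E, x 0 = x₀ → (∀ s ∈ Icc 0 t, x s ∈ U) →
      (∀ s ∈ Icc 0 t, HasDerivWithinAt x (v (x s)) (Icc 0 t) s) → x t ∈ K) :
    ∃ x : ℝ → E, x 0 = x₀ ∧ (∀ t ∈ Icc 0 T, x t ∈ U) ∧
      ∀ t ∈ Icc 0 T, HasDerivWithinAt x (v (x t)) (Icc 0 T) t := by
  have hx₀ : x₀ ∈ K := hap 0 ⟨le_rfl, hT⟩ (fun _ => x₀) rfl (fun _ _ => hx₀U) fun s hs => by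
    rw [Icc_self] at hs ⊢
    rw [mem_singleton_iff.1 hs]
    exact hasDerivWithinAt_iff_hasFDerivWithinAt.2 (HasFDerivWithinAt.singleton)
  obtain ⟨g, C, L, V, hg, hL, hV, hKV, hVU, hgv⟩ := exists_lipschitz_cutoff hU hK hKU hv
  -- the cut-off field is bounded and globally Lipschitz, so its solutions exist on any interval
  have hpl : IsPicardLindelof (fun _ => g) (tmin := 0) (tmax := T) ⟨0, left_mem_Icc.2 hT⟩ x₀
      (L * T.toNNReal) 0 L C :=
    { lipschitzOnWith := fun t _ => hg.lipschitzOnWith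
      continuousOn := fun x _ => continuousOn_const
      norm_le := fun t _ x _ => hL x
      mul_max_le := by simp [hT] }
  obtain ⟨x, hx0, hx⟩ := hpl.exists_eq_forall_mem_Icc_hasDerivWithinAt₀
  replace hx0 : x 0 = x₀ := hx0
  have hxc : ContinuousOn x (Icc 0 T) := fun t ht => (hx t ht).continuousWithinAt
  have hxV : ∀ t ∈ Icc 0 T, x t ∈ V := by
    by_contra! hcon
    -- at the first exit time `t₁` from `V`, the solution is in `K` by continuity
    have hcl : IsClosed (Icc 0 T ∩ x ⁻¹' Vᶜ) := hxc.preimage_isClosed_of_isClosed isClosed_Icc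
      hV.isClosed_compl
    have hcp : IsCompact (Icc 0 T ∩ x ⁻¹' Vᶜ) :=
      isCompact_Icc.of_isClosed_subset hcl inter_subset_left
    obtain ⟨t₁, ⟨ht₁, hxt₁⟩, hmin⟩ := hcp.exists_isLeast (by
      obtain ⟨t, ht, h⟩ := hcon
      exact ⟨t, ht, h⟩)
    have hbefore : ∀ t ∈ Ico 0 t₁, x t ∈ V := fun t ht => by
      by_contra h
      exact absurd (hmin ⟨⟨ht.1, ht.2.le.trans ht₁.2⟩, h⟩) (not_le.2 ht.2)
    have hKt : ∀ t ∈ Ico 0 t₁, x t ∈ K := fun t ht => by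
      have hs : Icc 0 t ⊆ Icc 0 T := Icc_subset_Icc_right (ht.2.le.trans ht₁.2)
      refine hap t ⟨ht.1, ht.2.le.trans ht₁.2⟩ x hx0
        (fun s hs' => hVU (hbefore s ⟨hs'.1, hs'.2.trans_lt ht.2⟩)) fun s hs' => ?_
      rw [← hgv (hbefore s ⟨hs'.1, hs'.2.trans_lt ht.2⟩)]
      exact (hx s (hs hs')).mono hs
    have hpos : 0 < t₁ := by
      rcases ht₁.1.eq_or_lt with h | h
      · rw [← h] at hxt₁
        exact absurd (hKV (hx0 ▸ hx₀)) hxt₁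
      · exact h
    have hlim : Tendsto x (𝓝[Ico 0 t₁] t₁) (𝓝 (x t₁)) :=
      (hxc t₁ ht₁).mono (fun t ht => ⟨ht.1, ht.2.le.trans ht₁.2⟩)
    have hne : (𝓝[Ico 0 t₁] t₁).NeBot := by
      rw [← mem_closure_iff_nhdsWithin_neBot, closure_Ico hpos.ne]
      exact right_mem_Icc.2 hpos.le
    exact hxt₁ (hKV (hK.isClosed.mem_of_tendsto hlim
      (eventually_nhdsWithin_of_forall hKt)))
  refine ⟨x, hx0, fun t ht => hVU (hxV t ht), fun t ht => ?_⟩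
  rw [← hgv (hxV t ht)]
  exact hx t ht

/-- Continuation of solutions: a `C¹` vector field on an open set has a solution for all future
time if, over each bounded time interval, the solutions are confined to a compact subset. -/
theorem exists_isIntegralCurveOn_Ici {E : Type*} [NormedAddCommGroup E] [NormedSpace ℝ E]
    [FiniteDimensional ℝ E] {U : Set E} (hU : IsOpen U)
    {v : E → E} (hv : ContDiffOn ℝ 1 v U) {x₀ : E} (hx₀ : x₀ ∈ U)
    (hap : ∀ T, 0 ≤ T → ∃ K, IsCompact K ∧ K ⊆ U ∧
      ∀ t ∈ Icc 0 T, ∀ x : ℝ → E, x 0 = x₀ → (∀ s ∈ Icc 0 t, x s ∈ U) →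
      (∀ s ∈ Icc 0 t, HasDerivWithinAt x (v (x s)) (Icc 0 t) s) → x t ∈ K) :
    ∃ x : ℝ → E, x 0 = x₀ ∧ (∀ t ∈ Ici (0 : ℝ), x t ∈ U) ∧
      ∀ t ∈ Ici (0 : ℝ), HasDerivWithinAt x (v (x t)) (Ici 0) t := by
  have key : ∀ n : ℕ, ∃ x : ℝ → E, x 0 = x₀ ∧ (∀ t ∈ Icc (0 : ℝ) n, x t ∈ U) ∧
      ∀ t ∈ Icc (0 : ℝ) n, HasDerivWithinAt x (v (x t)) (Icc 0 n) t := fun n => by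
    obtain ⟨K, hK, hKU, h⟩ := hap n n.cast_nonneg
    exact exists_isIntegralCurveOn_Icc hU hv n.cast_nonneg hK hKU hx₀ h
  choose x hx0 hxU hx using key
  have hagree : ∀ m n : ℕ, m ≤ n → EqOn (x m) (x n) (Icc 0 m) := fun m n hmn => by
    have hs : Icc (0 : ℝ) m ⊆ Icc 0 n := Icc_subset_Icc_right (by exact_mod_cast hmn)
    exact eqOn_of_isIntegralCurve hU hv (hx m) (hxU m) (fun t ht => (hx n t (hs ht)).mono hs)
      (fun t ht => hxU n t (hs ht)) ((hx0 m).trans (hx0 n).symm)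
  have hN : ∀ t : ℝ, t < (⌈t⌉₊ + 1 : ℕ) := fun t => by
    push_cast
    linarith [Nat.le_ceil t]
  have hglue : ∀ (t : ℝ) (n : ℕ), 0 ≤ t → t ≤ n → x (⌈t⌉₊ + 1) t = x n t := fun t n h0 hn => by
    rcases le_total (⌈t⌉₊ + 1) n with h | h
    · exact hagree _ _ h ⟨h0, (hN t).le⟩
    · exact (hagree _ _ h ⟨h0, hn⟩).symm
  refine ⟨fun t => x (⌈t⌉₊ + 1) t, hx0 _, fun t ht => hxU _ t ⟨ht, (hN t).le⟩, fun t ht => ?_⟩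
  have h1 := hx (⌈t⌉₊ + 1) t ⟨ht, (hN t).le⟩
  have hnb : Icc (0 : ℝ) (⌈t⌉₊ + 1 : ℕ) ∈ 𝓝[Ici 0] t := by
    rw [← Ici_inter_Iic]
    exact inter_mem self_mem_nhdsWithin (mem_nhdsWithin_of_mem_nhds (Iic_mem_nhds (hN t)))
  refine (h1.mono_of_mem_nhdsWithin hnb).congr_of_eventuallyEq ?_ rfl
  filter_upwards [hnb] with s hs
  exact hglue s _ hs.1 hs.2

/-! ### Scalar differential inequalities -/

theorem mul_sub_le_sub_of_le_derivWithin {I : Set ℝ} {f f' : ℝ → ℝ}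
    (hf : ∀ t ∈ I, HasDerivWithinAt f (f' t) I t) {c s t : ℝ} (hst : s ≤ t)
    (hI : Icc s t ⊆ I) (h : ∀ u ∈ Icc s t, c ≤ f' u) : c * (t - s) ≤ f t - f s := by
  have hd : ∀ u ∈ interior (Icc s t), HasDerivAt f (f' u) u := fun u hu =>
    ((hf u (hI (interior_subset hu))).mono hI).hasDerivAt (mem_interior_iff_mem_nhds.1 hu)
  exact (convex_Icc s t).mul_sub_le_image_sub_of_le_deriv
    (fun u hu => ((hf u (hI hu)).mono hI).continuousWithinAt)
    (fun u hu => (hd u hu).differentiableAt.differentiableWithinAt)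
    (fun u hu => by
      rw [(hd u hu).deriv]
      exact h u (interior_subset hu)) s (left_mem_Icc.2 hst) t (right_mem_Icc.2 hst) hst

theorem sub_le_mul_sub_of_derivWithin_le {I : Set ℝ} {f f' : ℝ → ℝ}
    (hf : ∀ t ∈ I, HasDerivWithinAt f (f' t) I t) {c s t : ℝ} (hst : s ≤ t)
    (hI : Icc s t ⊆ I) (h : ∀ u ∈ Icc s t, f' u ≤ c) : f t - f s ≤ c * (t - s) := by
  have := mul_sub_le_sub_of_le_derivWithin (f := fun t => -f t) (f' := fun t => -f' t)
    (fun t ht => (hf t ht).fun_neg) hst hI (c := -c) (fun u hu => neg_le_neg (h u hu))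
  linarith

theorem Icc_subset_Ici_zero {s t : ℝ} (hs : 0 ≤ s) : Icc s t ⊆ Ici 0 := fun _ hu => hs.trans hu.1

section Ici

variable {z z' : ℝ → ℝ}

theorem forall_le_of_deriv_neg (hz : ∀ t ∈ Ici (0 : ℝ), HasDerivWithinAt z (z' t) (Ici 0) t)
    {B T : ℝ} (hT : 0 ≤ T) (h0 : z T ≤ B) (h : ∀ t, T ≤ t → z t = B → z' t < 0) :
    ∀ t, T ≤ t → z t ≤ B := fun t ht =>
  image_le_of_deriv_right_lt_deriv_boundary (a := T) (b := t) (f' := z') (B := fun _ => B)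
    (B' := fun _ => 0)
    (fun u hu => ((hz u (hT.trans hu.1)).mono (Icc_subset_Ici_zero hT)).continuousWithinAt)
    (fun u hu => (hz u (hT.trans hu.1)).mono fun _ hv => (hT.trans hu.1).trans hv) h0
    (fun x => hasDerivAt_const x B) (fun u hu he => h u hu.1 he) (right_mem_Icc.2 ht)

/-- If `z` decreases at a definite rate wherever it is at least `b`, it ends up below `b`. -/
theorem eventually_le_of_deriv_le
    (hz : ∀ t ∈ Ici (0 : ℝ), HasDerivWithinAt z (z' t) (Ici 0) t) {b c : ℝ} (hc : 0 < c)
    (h : ∀ᶠ t in atTop, b ≤ z t → z' t ≤ -c) : ∀ᶠ t in atTop, z t ≤ b := by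
  obtain ⟨T, hT0, hT⟩ := ((eventually_ge_atTop (0 : ℝ)).and (eventually_forall_ge_atTop.2 h)).exists
  have hex : ∃ t, T ≤ t ∧ z t ≤ b := by
    by_contra! hcon
    have hTt : T ≤ T + (z T - b) / c + 1 := by
      have : 0 < (z T - b) / c := div_pos (sub_pos.2 (hcon T le_rfl)) hc
      linarith
    have h1 := sub_le_mul_sub_of_derivWithin_le hz hTt (Icc_subset_Ici_zero hT0)
      (c := -c) (fun u hu => hT u hu.1 (hcon u hu.1).le)
    have h2 := hcon _ hTt
    have h3 : c * ((z T - b) / c) = z T - b := mul_div_cancel₀ _ hc.ne'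
    nlinarith
  obtain ⟨t₁, ht₁, hb⟩ := hex
  filter_upwards [eventually_ge_atTop t₁] with t ht
  exact forall_le_of_deriv_neg hz (hT0.trans ht₁) hb
    (fun u hu he => (hT u (ht₁.trans hu) he.ge).trans_lt (neg_lt_zero.2 hc)) t ht

/-- A version of `eventually_le_of_deriv_le` where the rate of decrease is known only in a window
`[b, B]` that `z` enters, or underneath which it is, at arbitrarily late times. -/
theorem eventually_le_of_deriv_le_of_frequently_le
    (hz : ∀ t ∈ Ici (0 : ℝ), HasDerivWithinAt z (z' t) (Ici 0) t) {b B c : ℝ} (hc : 0 < c)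
    (hbB : b ≤ B) (hB : ∃ᶠ t in atTop, z t ≤ B)
    (h : ∀ᶠ t in atTop, b ≤ z t → z t ≤ B → z' t ≤ -c) : ∀ᶠ t in atTop, z t ≤ b := by
  obtain ⟨T, hTB, hT0, hT⟩ :=
    (hB.and_eventually ((eventually_ge_atTop (0 : ℝ)).and (eventually_forall_ge_atTop.2 h))).exists
  have hstay := forall_le_of_deriv_neg hz hT0 hTB
    (fun u hu he => (hT u hu (hbB.trans he.ge) he.le).trans_lt (neg_lt_zero.2 hc))
  refine eventually_le_of_deriv_le hz hc ?_
  filter_upwards [eventually_ge_atTop T] with t ht hb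
  exact hT t ht hb (hstay t ht)

theorem eventually_ge_of_le_deriv
    (hz : ∀ t ∈ Ici (0 : ℝ), HasDerivWithinAt z (z' t) (Ici 0) t) {b c : ℝ} (hc : 0 < c)
    (h : ∀ᶠ t in atTop, z t ≤ b → c ≤ z' t) : ∀ᶠ t in atTop, b ≤ z t := by
  have := eventually_le_of_deriv_le (z := fun t => -z t) (z' := fun t => -z' t)
    (fun t ht => (hz t ht).fun_neg) hc (b := -b) (by
      filter_upwards [h] with t ht hb
      linarith [ht (neg_le_neg_iff.1 hb)])
  filter_upwards [this] with t ht
  exact neg_le_neg_iff.1 ht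

/-- **Barbalat's lemma**, for a lower bound `φ` of the derivative of a bounded function. -/
theorem tendsto_zero_of_le_deriv (hz : ∀ t ∈ Ici (0 : ℝ), HasDerivWithinAt z (z' t) (Ici 0) t)
    {φ : ℝ → ℝ} (hφ : UniformContinuousOn φ (Ici 0)) (h0 : ∀ t ∈ Ici (0 : ℝ), 0 ≤ φ t)
    (hle : ∀ t ∈ Ici (0 : ℝ), φ t ≤ z' t) {B : ℝ} (hB : ∀ t ∈ Ici (0 : ℝ), z t ≤ B) :
    Tendsto φ atTop (𝓝 0) := by
  have hmono : ∀ s t, 0 ≤ s → s ≤ t → z s ≤ z t := fun s t hs hst => by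
    have := mul_sub_le_sub_of_le_derivWithin hz hst (Icc_subset_Ici_zero hs) (c := 0)
      (fun u hu => (h0 u (hs.trans hu.1)).trans (hle u (hs.trans hu.1)))
    linarith
  rw [Metric.tendsto_atTop]
  by_contra! hcon
  obtain ⟨ε, hε, hfreq⟩ := hcon
  obtain ⟨δ, hδ, huc⟩ := Metric.uniformContinuousOn_iff.1 hφ (ε / 2) (half_pos hε)
  -- each visit of `φ` above `ε` raises `z` by a fixed amount
  have hstep : ∀ n : ℕ, ∃ t, 0 ≤ t ∧ z 0 + n * (ε / 2 * (δ / 2)) ≤ z t := fun n => by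
    induction n with
    | zero => exact ⟨0, le_rfl, by simp⟩
    | succ n ih =>
      obtain ⟨t, ht, hzt⟩ := ih
      obtain ⟨s, hs, hφs⟩ := hfreq t
      have hs0 : 0 ≤ s := ht.trans hs
      rw [Real.dist_eq, sub_zero, abs_of_nonneg (h0 s hs0)] at hφs
      have h1 := mul_sub_le_sub_of_le_derivWithin hz (s := s) (t := s + δ / 2) (by linarith)
        (Icc_subset_Ici_zero hs0) (c := ε / 2) (fun u hu => by
          have hd := huc s hs0 u (hs0.trans hu.1) (by
            rw [Real.dist_eq, abs_sub_comm, abs_of_nonneg (sub_nonneg.2 hu.1)]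
            linarith [hu.2])
          rw [Real.dist_eq] at hd
          linarith [(abs_lt.1 hd).2, hle u (hs0.trans hu.1)])
      refine ⟨s + δ / 2, by linarith, ?_⟩
      have h2 := hmono t s ht hs
      push_cast
      rw [add_sub_cancel_left] at h1
      linarith
  obtain ⟨n, hn⟩ := exists_nat_gt ((B - z 0) / (ε / 2 * (δ / 2)))
  obtain ⟨t, ht, hzt⟩ := hstep n
  rw [div_lt_iff₀ (by positivity)] at hn
  linarith [hB t ht]

theorem uniformContinuousOn_of_deriv_bounded
    (hz : ∀ t ∈ Ici (0 : ℝ), HasDerivWithinAt z (z' t) (Ici 0) t) {C : ℝ}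
    (hC : ∀ t ∈ Ici (0 : ℝ), |z' t| ≤ C) : UniformContinuousOn z (Ici 0) := by
  have hC0 : 0 ≤ C := (abs_nonneg _).trans (hC 0 self_mem_Ici)
  refine ((convex_Ici 0).lipschitzOnWith_of_nnnorm_hasDerivWithin_le (C := C.toNNReal) hz
    fun t ht => ?_).uniformContinuousOn
  rw [← NNReal.coe_le_coe, Real.coe_toNNReal _ hC0]
  exact hC t ht

end Ici

theorem tendsto_zero_of_const_mul_sq {f : ℝ → ℝ} {c : ℝ} (hc : c ≠ 0)
    (h : Tendsto (fun t => c * f t ^ 2) atTop (𝓝 0)) : Tendsto f atTop (𝓝 0) := by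
  have h1 := (h.const_mul c⁻¹).sqrt
  rw [mul_zero, Real.sqrt_zero] at h1
  rw [tendsto_zero_iff_abs_tendsto_zero]
  refine h1.congr fun t => ?_
  rw [inv_mul_cancel_left₀ hc, Real.sqrt_sq_eq_abs, Function.comp_apply]

theorem tendsto_const_mul_exp_neg (C : ℝ) {c : ℝ} (hc : 0 < c) :
    Tendsto (fun t => C * Real.exp (-c * t)) atTop (𝓝 0) := by
  have h := tendsto_id.const_mul_atTop_of_neg (neg_lt_zero.2 hc)
  simpa using (Real.tendsto_exp_atBot.comp h).const_mul C

/-- A continuous function of three bounded, uniformly continuous functions is uniformly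
continuous. -/
theorem uniformContinuousOn_comp₃ {I : Set ℝ} {x y z : ℝ → ℝ} (hx : UniformContinuousOn x I)
    (hy : UniformContinuousOn y I) (hz : UniformContinuousOn z I) {B : ℝ}
    (hxB : ∀ t ∈ I, |x t| ≤ B) (hyB : ∀ t ∈ I, |y t| ≤ B) (hzB : ∀ t ∈ I, |z t| ≤ B)
    {g : ℝ × ℝ × ℝ → ℝ} (hg : Continuous g) :
    UniformContinuousOn (fun t => g (x t, y t, z t)) I := by
  have hK : IsCompact (Icc (-B) B ×ˢ Icc (-B) B ×ˢ Icc (-B) B) :=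
    isCompact_Icc.prod (isCompact_Icc.prod isCompact_Icc)
  refine (hK.uniformContinuousOn_of_continuous hg.continuousOn).comp
    (f := fun t => (x t, y t, z t)) ?_ fun t ht =>
    ⟨abs_le.1 (hxB t ht), abs_le.1 (hyB t ht), abs_le.1 (hzB t ht)⟩
  rw [uniformContinuousOn_iff_restrict] at *
  exact hx.prodMk (hy.prodMk hz)

/-! ### Orbits in terms of the scalar variables -/

/-- The normalised energy density `Ω` as a function of `Σ₊` and `M₁`. -/
noncomputable def om (S M : ℝ) : ℝ := 1 - S ^ 2 - M ^ 2 / 12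

/-- The deceleration parameter as a function of `Σ₊` and `M₁`. -/
noncomputable def dec (w S M : ℝ) : ℝ := 2 * S ^ 2 + (1 + 3 * w) / 2 * om S M

/-- The right-hand side of the `H_D`-equation. -/
noncomputable def rateH (w H S M : ℝ) : ℝ := (H ^ 2 - 1) * (dec w S M - H * S)

/-- The right-hand side of the `Σ₊`-equation, where `κ` is the value of `w₂(s) - w`. -/
noncomputable def rateS (w κ H S M : ℝ) : ℝ :=
  -(2 - dec w S M) * H * S + (H ^ 2 - 1) * (1 - S ^ 2) + M ^ 2 / 3 + 3 * om S M * κ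

/-- The right-hand side of the `M₁`-equation. -/
noncomputable def rateM (w H S M : ℝ) : ℝ := M * (dec w S M * H - 4 * S - (H ^ 2 - 1) * S)

/-- `(H, S, M)` solves the reduced Einstein equations on the time interval `I` with anisotropy
`w₂(s) - w = κ`, and stays in the region of expanding models with `Ω ≥ 0`, which comprises the
matter-filled models and the vacuum ones. -/
structure IsOrbit (w : ℝ) (κ H S M : ℝ → ℝ) (I : Set ℝ) : Prop where
  one_lt : ∀ t ∈ I, 1 < H t
  neg_one_lt : ∀ t ∈ I, -1 < S t
  lt_one : ∀ t ∈ I, S t < 1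
  pos : ∀ t ∈ I, 0 < M t
  om_nonneg : ∀ t ∈ I, 0 ≤ om (S t) (M t)
  deriv_H : ∀ t ∈ I, HasDerivWithinAt H (rateH w (H t) (S t) (M t)) I t
  deriv_S : ∀ t ∈ I, HasDerivWithinAt S (rateS w (κ t) (H t) (S t) (M t)) I t
  deriv_M : ∀ t ∈ I, HasDerivWithinAt M (rateM w (H t) (S t) (M t)) I t

section Pointwise

variable {w κ H S M : ℝ}

theorem dec_le_two (hw : w < 1) (hO : 0 ≤ om S M) : dec w S M ≤ 2 := by
  unfold dec
  have : om S M ≤ 1 - S ^ 2 := by unfold om; nlinarith [sq_nonneg M]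
  nlinarith

theorem dec_nonneg (hw : -1 / 3 < w) (hO : 0 ≤ om S M) : 0 ≤ dec w S M := by
  unfold dec
  nlinarith [sq_nonneg S, mul_nonneg (by linarith : 0 ≤ 1 + 3 * w) hO]

theorem om_le : om S M ≤ 1 - S ^ 2 := by
  unfold om
  nlinarith [sq_nonneg M]

theorem two_sub_dec_le (hw : -1 / 3 < w) (hO : 0 ≤ om S M) :
    2 - dec w S M ≤ 2 * (1 - S ^ 2) := by
  unfold dec
  nlinarith [mul_nonneg (by linarith : 0 ≤ 1 + 3 * w) hO]

end Pointwise

/-- The derivative of `Ω` is a multiple of `Ω`; hence the set `Ω = 0` of vacuum states is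
invariant. -/
theorem hasDerivWithinAt_om_of_rate {w κ H t : ℝ} {S M : ℝ → ℝ} {I : Set ℝ}
    (hS : HasDerivWithinAt S (rateS w κ H (S t) (M t)) I t)
    (hM : HasDerivWithinAt M (rateM w H (S t) (M t)) I t) :
    HasDerivWithinAt (fun t => om (S t) (M t))
      (om (S t) (M t) * ((2 * dec w (S t) (M t) - (1 + 3 * w)) * H
        - 2 * (H ^ 2 - 1) * S t - 6 * S t * κ)) I t := by
  convert! ((hS.pow 2).const_sub 1).sub ((hM.pow 2).div_const 12) using 1
  unfold rateS rateM dec om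
  simp
  ring

namespace IsOrbit

variable {w : ℝ} {κ H S M : ℝ → ℝ} {I : Set ℝ}

variable (h : IsOrbit w κ H S M I) {t : ℝ} (ht : t ∈ I)
include h ht

theorem sq_sub_one_pos : 0 < H t ^ 2 - 1 := by nlinarith [h.one_lt t ht]

theorem one_sub_sq_pos : 0 < 1 - S t ^ 2 := by nlinarith [h.neg_one_lt t ht, h.lt_one t ht]

theorem abs_S_le : |S t| ≤ 1 := abs_le.2 ⟨(h.neg_one_lt t ht).le, (h.lt_one t ht).le⟩

theorem M_lt_four : M t < 4 := by
  have h1 := h.om_nonneg t ht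
  unfold om at h1
  nlinarith [h.pos t ht, sq_nonneg (S t)]

theorem hasDerivWithinAt_log_sq_sub_one :
    HasDerivWithinAt (fun t => Real.log (H t ^ 2 - 1))
      (2 * H t * (dec w (S t) (M t) - H t * S t)) I t := by
  have hk := h.sq_sub_one_pos ht
  convert! (((h.deriv_H t ht).pow 2).sub_const 1).log hk.ne' using 1
  unfold rateH
  rw [Pi.pow_apply, eq_div_iff hk.ne']
  simp
  ring

theorem log_sq_sub_one_le : Real.log (H t ^ 2 - 1) ≤ 2 * Real.log (H t) := by
  have := Real.log_le_log (h.sq_sub_one_pos ht) (by linarith : H t ^ 2 - 1 ≤ H t ^ 2)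
  rw [Real.log_pow] at this
  exact_mod_cast this

theorem hasDerivWithinAt_log_M :
    HasDerivWithinAt (fun t => Real.log (M t))
      (dec w (S t) (M t) * H t - 4 * S t - (H t ^ 2 - 1) * S t) I t := by
  have hk := h.pos t ht
  convert! (h.deriv_M t ht).log hk.ne' using 1
  unfold rateM
  rw [mul_div_cancel_left₀ _ hk.ne']

theorem hasDerivWithinAt_log_H :
    HasDerivWithinAt (fun t => Real.log (H t))
      ((H t - 1 / H t) * (dec w (S t) (M t) - H t * S t)) I t := by
  have hk : 0 < H t := by linarith [h.one_lt t ht]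
  convert! (h.deriv_H t ht).log hk.ne' using 1
  unfold rateH
  field_simp

theorem hasDerivWithinAt_om :
    HasDerivWithinAt (fun t => om (S t) (M t))
      (om (S t) (M t) * ((2 * dec w (S t) (M t) - (1 + 3 * w)) * H t
        - 2 * (H t ^ 2 - 1) * S t - 6 * S t * κ t)) I t :=
  hasDerivWithinAt_om_of_rate (h.deriv_S t ht) (h.deriv_M t ht)

theorem hasDerivWithinAt_log_om (hO : 0 < om (S t) (M t)) :
    HasDerivWithinAt (fun t => Real.log (om (S t) (M t)))
      ((2 * dec w (S t) (M t) - (1 + 3 * w)) * H t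
        - 2 * (H t ^ 2 - 1) * S t - 6 * S t * κ t) I t := by
  convert! (h.hasDerivWithinAt_om ht).log hO.ne' using 1
  rw [mul_div_cancel_left₀ _ hO.ne']

theorem hasDerivWithinAt_log_sub {v : ℝ} (hv : 0 < H t - v * S t) :
    HasDerivWithinAt (fun t => Real.log (H t - v * S t))
      ((rateH w (H t) (S t) (M t) - v * rateS w (κ t) (H t) (S t) (M t)) / (H t - v * S t)) I t :=
  ((h.deriv_H t ht).sub ((h.deriv_S t ht).const_mul v)).log hv.ne'

theorem le_rateS_of_nonneg (hw : -1 / 3 < w) (hS : 0 ≤ S t) :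
    (1 - S t ^ 2) * (H t ^ 2 - 1 - 2 * H t * S t) + M t ^ 2 / 3 + 3 * om (S t) (M t) * κ t
      ≤ rateS w (κ t) (H t) (S t) (M t) := by
  have h1 := h.one_lt t ht
  have h2 := mul_le_mul_of_nonneg_right (two_sub_dec_le (S := S t) (M := M t) hw
    (h.om_nonneg t ht)) (mul_nonneg (by linarith : 0 ≤ H t) hS)
  unfold rateS
  nlinarith

theorem le_rateS_of_nonpos (hw : w < 1) (hS : S t ≤ 0) :
    (1 - S t ^ 2) * (H t ^ 2 - 1) + M t ^ 2 / 3 + 3 * om (S t) (M t) * κ t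
      ≤ rateS w (κ t) (H t) (S t) (M t) := by
  have h1 := h.one_lt t ht
  have h2 := mul_nonneg (sub_nonneg.2 (dec_le_two (S := S t) (M := M t) hw (h.om_nonneg t ht)))
    (mul_nonneg (by linarith : 0 ≤ H t) (neg_nonneg.2 hS))
  unfold rateS
  nlinarith

end IsOrbit

/-! ### A priori bounds -/

/-- Bounds that keep the variables `(H_D, Σ₊, M₁)` in a compact set, away from the boundary
`H_D = 1`, `M₁ = 0` of the region of expanding models, and from the vacuum boundary if `δ > 0`. -/
def box (ε δ b : ℝ) : Set XCoord :=
  {x | 1 + ε ≤ x.1 ∧ x.1 ≤ b ∧ -1 ≤ x.2.1 ∧ x.2.1 ≤ 1 ∧ ε ≤ x.2.2 ∧ x.2.2 ≤ 4 ∧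
    δ ≤ om x.2.1 x.2.2}

theorem continuous_om : Continuous fun x : XCoord => om x.2.1 x.2.2 := by
  unfold om
  fun_prop

theorem isCompact_box (ε δ b : ℝ) : IsCompact (box ε δ b) := by
  have hK : IsCompact (Icc (1 + ε) b ×ˢ Icc (-1 : ℝ) 1 ×ˢ Icc ε 4) :=
    isCompact_Icc.prod (isCompact_Icc.prod isCompact_Icc)
  have hcl : IsClosed (box ε δ b) := by
    have := continuous_om
    simp only [box, ofPred_and]
    refine (isClosed_le ?_ ?_).inter <| (isClosed_le ?_ ?_).inter <| (isClosed_le ?_ ?_).inter <|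
      (isClosed_le ?_ ?_).inter <| (isClosed_le ?_ ?_).inter <| (isClosed_le ?_ ?_).inter <|
      isClosed_le ?_ ?_ <;> fun_prop
  exact hK.of_isClosed_subset hcl fun x hx =>
    ⟨⟨hx.1, hx.2.1⟩, ⟨hx.2.2.1, hx.2.2.2.1⟩, ⟨hx.2.2.2.2.1, hx.2.2.2.2.2.1⟩⟩

/-- The function `log (H / (1 + S))` grows at most linearly, whence `H` cannot blow up and `S`
cannot reach `-1` in finite time. -/
theorem IsOrbit.log_sub_log_rate_le {w : ℝ} {κ H S M : ℝ → ℝ} {I : Set ℝ}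
    (h : IsOrbit w κ H S M I) (hw : -1 / 3 < w) (hw1 : w < 1) {K : ℝ}
    {t : ℝ} (ht : t ∈ I) (hκ : |κ t| ≤ K) :
    (H t - 1 / H t) * (dec w (S t) (M t) - H t * S t)
      - rateS w (κ t) (H t) (S t) (M t) / (1 + S t) ≤ 5 + 6 * K := by
  have h1 := h.one_lt t ht
  have h2 := h.neg_one_lt t ht
  have h3 := h.lt_one t ht
  have hO := h.om_nonneg t ht
  have hk := h.sq_sub_one_pos ht
  have hS2 := h.one_sub_sq_pos ht
  have hK : 0 ≤ K := (abs_nonneg _).trans hκ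
  have hq := dec_le_two (S := S t) (M := M t) hw1 hO
  have hOle := om_le (S := S t) (M := M t)
  have hOκ : -(K * (1 - S t ^ 2)) ≤ om (S t) (M t) * κ t := by
    have := abs_le.1 hκ
    nlinarith [mul_le_mul_of_nonneg_left this.1 hO]
  have hlow : (1 + S t) * ((H t ^ 2 - 1) * (1 - S t) - 2 * H t - 6 * K)
      ≤ rateS w (κ t) (H t) (S t) (M t) := by
    have hM := sq_nonneg (M t)
    have hfac : (1 + S t) * (1 - S t) = 1 - S t ^ 2 := by ring
    have hKS : K * (1 - S t ^ 2) ≤ 2 * K * (1 + S t) := by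
      rw [← hfac]
      nlinarith [mul_nonneg hK (by linarith : 0 ≤ 1 + S t)]
    rcases le_total 0 (S t) with hS | hS
    · have h5 := h.le_rateS_of_nonneg ht hw hS
      have h6 : (1 - S t ^ 2) * (2 * H t * S t) ≤ 2 * H t * (1 + S t) := by
        rw [← hfac]
        have : (1 - S t) * S t ≤ 1 := by nlinarith
        nlinarith [mul_le_mul_of_nonneg_left this (by nlinarith : 0 ≤ 2 * H t * (1 + S t))]
      nlinarith
    · have h5 := h.le_rateS_of_nonpos ht hw1 hS
      nlinarith [mul_nonneg (by linarith : 0 ≤ 2 * H t) (by linarith : 0 ≤ 1 + S t)]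
  have hlow' : (H t ^ 2 - 1) * (1 - S t) - 2 * H t - 6 * K
      ≤ rateS w (κ t) (H t) (S t) (M t) / (1 + S t) := by
    rw [le_div_iff₀ (by linarith)]
    linarith
  have hup : (H t - 1 / H t) * (dec w (S t) (M t) - H t * S t)
      ≤ 2 * H t - (H t ^ 2 - 1) * S t := by
    have e : (H t - 1 / H t) * (dec w (S t) (M t) - H t * S t)
        = (H t - 1 / H t) * dec w (S t) (M t) - (H t ^ 2 - 1) * S t := by
      field_simp
    rw [e]
    have i1 : 0 < 1 / H t := by positivity
    have i2 : 0 ≤ H t - 1 / H t := by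
      rw [sub_nonneg, div_le_iff₀ (by linarith)]
      nlinarith
    nlinarith [mul_le_mul_of_nonneg_left hq i2]
  nlinarith [sq_nonneg (H t - 2)]

theorem exp_le_of_log_rate {f g : ℝ → ℝ} {T C : ℝ} (hT : 0 ≤ T)
    (hf : ∀ t ∈ Icc 0 T, 0 < f t)
    (hd : ∀ t ∈ Icc 0 T, HasDerivWithinAt (fun t => Real.log (f t)) (g t) (Icc 0 T) t)
    (hg : ∀ t ∈ Icc 0 T, -C ≤ g t) : f 0 * Real.exp (-C * T) ≤ f T := by
  have h1 := mul_sub_le_sub_of_le_derivWithin hd hT subset_rfl hg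
  have h0 := hf 0 ⟨le_rfl, hT⟩
  have hT' := hf T ⟨hT, le_rfl⟩
  rw [← Real.log_le_log_iff (by positivity) hT', Real.log_mul h0.ne' (Real.exp_pos _).ne',
    Real.log_exp]
  rw [sub_zero] at h1
  linarith

/-- Over a bounded time interval, orbits with given initial state are confined to a compact
set. The upper bound of `H` comes first; with it, the logarithmic derivatives of `H² - 1`, `M` and
`Ω` are bounded below. -/
theorem exists_mem_box {w : ℝ} (hw : -1 / 3 < w) (hw1 : w < 1) {K : ℝ} (hK : 0 ≤ K) {T : ℝ}
    {H₀ S₀ M₀ : ℝ} (hH₀ : 1 < H₀) (hS₀ : -1 < S₀) (hM₀ : 0 < M₀) :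
    ∃ ε b c : ℝ, 0 < ε ∧ 0 < c ∧ ∀ (κ H S M : ℝ → ℝ), ∀ t ∈ Icc 0 T,
      IsOrbit w κ H S M (Icc 0 t) → (∀ s ∈ Icc 0 t, |κ s| ≤ K) → H 0 = H₀ → S 0 = S₀ → M 0 = M₀ →
      (H t, S t, M t) ∈ box ε 0 b ∧
      ((∀ s ∈ Icc 0 t, 0 < om (S s) (M s)) → c * om S₀ M₀ ≤ om (S t) (M t)) := by
  set b : ℝ := 2 * (H₀ / (1 + S₀) * Real.exp ((5 + 6 * K) * T)) with hb
  have hS₀' : 0 < 1 + S₀ := by linarith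
  have hb0 : 0 < b := by positivity
  set C₁ : ℝ := 2 * b ^ 2
  set C₂ : ℝ := b ^ 2 + 3
  set C₃ : ℝ := 4 * b + 2 * b ^ 2 + 6 * K
  set ε₁ : ℝ := (H₀ ^ 2 - 1) * Real.exp (-C₁ * T)
  set ε₂ : ℝ := M₀ * Real.exp (-C₂ * T)
  have hk₀ : 0 < H₀ ^ 2 - 1 := by nlinarith
  have hε₁ : 0 < ε₁ := by positivity
  have hε₂ : 0 < ε₂ := by positivity
  have hexp : ∀ C t, 0 ≤ C → t ≤ T → Real.exp (-C * T) ≤ Real.exp (-C * t) := fun C t hC ht =>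
    Real.exp_le_exp.2 (by nlinarith)
  refine ⟨min (ε₁ / (b + 1)) ε₂, b, Real.exp (-C₃ * T), by positivity, by positivity, ?_⟩
  intro κ H S M t ht h hκ h0H h0S h0M
  have htt : t ∈ Icc 0 t := ⟨ht.1, le_rfl⟩
  have hHb : ∀ s ∈ Icc 0 t, H s ≤ b := fun s hs => by
    have hd : ∀ u ∈ Icc 0 t, HasDerivWithinAt (fun u => Real.log (H u) - Real.log (1 + S u)) _
        (Icc 0 t) u := fun u hu => (h.hasDerivWithinAt_log_H hu).sub
      (((h.deriv_S u hu).const_add 1).log (by linarith [h.neg_one_lt u hu]))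
    have h1 := sub_le_mul_sub_of_derivWithin_le hd hs.1 (Icc_subset_Icc_right hs.2)
      (c := 5 + 6 * K) fun u hu => h.log_sub_log_rate_le hw hw1 ⟨hu.1, hu.2.trans hs.2⟩
        (hκ u ⟨hu.1, hu.2.trans hs.2⟩)
    have i1 := h.one_lt s hs
    have i2 := h.neg_one_lt s hs
    have i3 := h.lt_one s hs
    rw [← Real.log_div (by linarith) (by linarith), h0H, h0S,
      ← Real.log_div (by linarith) (by linarith)] at h1
    have h2 : Real.log (H s / (1 + S s)) ≤
        Real.log (H₀ / (1 + S₀) * Real.exp ((5 + 6 * K) * T)) := by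
      rw [Real.log_mul (by positivity) (by positivity), Real.log_exp]
      have : (5 + 6 * K) * (s - 0) ≤ (5 + 6 * K) * T := by
        have := hs.2.trans ht.2
        gcongr
        linarith
      linarith
    rw [Real.log_le_log_iff (div_pos (by linarith) (by linarith)) (by positivity)] at h2
    rw [div_le_iff₀ (by linarith)] at h2
    have hE : 0 < H₀ / (1 + S₀) * Real.exp ((5 + 6 * K) * T) := by positivity
    rw [hb]
    nlinarith
  have hk : ε₁ ≤ H t ^ 2 - 1 := by
    have := exp_le_of_log_rate (f := fun t => H t ^ 2 - 1) (C := C₁) ht.1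
      (fun u hu => h.sq_sub_one_pos hu) (fun u hu => h.hasDerivWithinAt_log_sq_sub_one hu)
      fun u hu => by
        have i1 := h.one_lt u hu
        have i2 := hHb u hu
        have i3 := h.lt_one u hu
        have i4 := dec_nonneg hw (h.om_nonneg u hu)
        have i5 : -H u ≤ dec w (S u) (M u) - H u * S u := by nlinarith
        simp only [C₁]
        nlinarith
    refine le_trans ?_ this
    rw [h0H]
    exact mul_le_mul_of_nonneg_left (hexp C₁ t (by positivity) ht.2) hk₀.le
  have hM : ε₂ ≤ M t := by
    have := exp_le_of_log_rate (f := M) (C := C₂) ht.1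
      (fun u hu => h.pos u hu) (fun u hu => h.hasDerivWithinAt_log_M hu)
      fun u hu => by
        have i1 := h.one_lt u hu
        have i2 := hHb u hu
        have i3 := h.lt_one u hu
        have i4 := dec_nonneg hw (h.om_nonneg u hu)
        simp only [C₂]
        nlinarith [mul_nonneg i4 (by linarith : 0 ≤ H u)]
    refine le_trans ?_ this
    rw [h0M]
    exact mul_le_mul_of_nonneg_left (hexp C₂ t (by positivity) ht.2) hM₀.le
  have i1 := h.one_lt t htt
  have i2 := hHb t htt
  refine ⟨⟨?_, i2, (h.neg_one_lt t htt).le, (h.lt_one t htt).le, (min_le_right _ _).trans hM,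
    (h.M_lt_four htt).le, h.om_nonneg t htt⟩, fun hO => ?_⟩
  · have : ε₁ / (b + 1) ≤ H t - 1 := by
      rw [div_le_iff₀ (by linarith)]
      nlinarith
    have := (min_le_left (ε₁ / (b + 1)) ε₂).trans this
    dsimp only
    linarith
  · have := exp_le_of_log_rate (f := fun u => om (S u) (M u)) (C := C₃) ht.1 hO
      (fun u hu => h.hasDerivWithinAt_log_om hu (hO u hu))
      fun u hu => by
        have i1 := h.one_lt u hu
        have i2 := hHb u hu
        have i4 := dec_nonneg hw (h.om_nonneg u hu)
        have i5 := abs_le.1 (h.abs_S_le hu)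
        have i6 : S u * κ u ≤ K := (le_abs_self _).trans (by
          rw [abs_mul]
          nlinarith [h.abs_S_le hu, hκ u hu, abs_nonneg (κ u), abs_nonneg (S u)])
        have i7 : (H u ^ 2 - 1) * S u ≤ b ^ 2 := by nlinarith [h.sq_sub_one_pos hu]
        have i8 : (1 + 3 * w) * H u ≤ 4 * b := by nlinarith
        simp only [C₃]
        nlinarith [mul_nonneg i4 (by linarith : 0 ≤ H u)]
    refine le_trans ?_ this
    simp only [h0S, h0M]
    have h0 := hO 0 ⟨le_rfl, ht.1⟩
    rw [h0S, h0M] at h0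
    rw [mul_comm]
    exact mul_le_mul_of_nonneg_left (hexp C₃ t (by positivity) ht.2) h0.le

/-! ### Coordinates and existence of solutions -/

/-- The open region of the variables `(H_D, Σ₊, M₁)` in which the vector field is regular; no sign
of `Ω` is imposed. -/
def region : Set XCoord := {x | 1 < x.1 ∧ -1 < x.2.1 ∧ x.2.1 < 1 ∧ 0 < x.2.2}

/-- The blown-up coordinates of the points of `region`. -/
def blownRegion : Set YCoord :=
  {y | 0 < y.1 ∧ (Real.pi / 2 < y.2.1 ∧ y.2.1 < Real.pi) ∧ (-1 < y.2.2 ∧ y.2.2 < 1)}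

/-- The inverse of `toX` on `region`, from `tan (π - θ) = 2 M² / (3 (H² - 1))`. -/
noncomputable def fromX (x : XCoord) : YCoord :=
  (Real.sqrt (((x.1 ^ 2 - 1) / 2) ^ 2 + (x.2.2 ^ 2 / 3) ^ 2),
    Real.pi - Real.arctan (2 / 3 * (x.2.2 ^ 2 / (x.1 ^ 2 - 1))), x.2.1)

theorem isOpen_region : IsOpen region := by
  simp only [region, ofPred_and]
  refine (isOpen_lt ?_ ?_).inter <| (isOpen_lt ?_ ?_).inter <| (isOpen_lt ?_ ?_).inter <|
    isOpen_lt ?_ ?_ <;> fun_prop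

section Coordinates

variable {y : YCoord} (hy : y ∈ blownRegion)
include hy

theorem cos_neg_of_mem : Real.cos y.2.1 < 0 :=
  Real.cos_neg_of_pi_div_two_lt_of_lt hy.2.1.1 (by linarith [hy.2.1.2, Real.pi_pos])

theorem sin_pos_of_mem : 0 < Real.sin y.2.1 :=
  Real.sin_pos_of_pos_of_lt_pi (by linarith [hy.2.1.1, Real.pi_pos]) hy.2.1.2

theorem toX_fst_sq : (toX y).1 ^ 2 = 1 - 2 * y.1 * Real.cos y.2.1 :=
  Real.sq_sqrt (by nlinarith [cos_neg_of_mem hy, hy.1])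

theorem toX_thd_sq : (toX y).2.2 ^ 2 = 3 * y.1 * Real.sin y.2.1 :=
  Real.sq_sqrt (by nlinarith [mul_pos hy.1 (sin_pos_of_mem hy)])

theorem toX_mem_region : toX y ∈ region := by
  have hc := cos_neg_of_mem hy
  have hs := sin_pos_of_mem hy
  refine ⟨?_, hy.2.2.1, hy.2.2.2, Real.sqrt_pos.2 (by nlinarith [mul_pos hy.1 hs])⟩
  exact Real.lt_sqrt_of_sq_lt (by nlinarith [hy.1])

theorem fromX_toX : fromX (toX y) = y := by
  have hc := cos_neg_of_mem hy
  have hs := sin_pos_of_mem hy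
  have hr := hy.1
  unfold fromX
  rw [toX_fst_sq hy, toX_thd_sq hy]
  refine Prod.ext ?_ (Prod.ext ?_ rfl)
  · dsimp only
    have : ((1 - 2 * y.1 * Real.cos y.2.1 - 1) / 2) ^ 2 + (3 * y.1 * Real.sin y.2.1 / 3) ^ 2
        = y.1 ^ 2 * (Real.sin y.2.1 ^ 2 + Real.cos y.2.1 ^ 2) := by ring
    rw [this, Real.sin_sq_add_cos_sq, mul_one, Real.sqrt_sq hr.le]
  · dsimp only
    have : 2 / 3 * (3 * y.1 * Real.sin y.2.1 / (1 - 2 * y.1 * Real.cos y.2.1 - 1))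
        = Real.tan (Real.pi - y.2.1) := by
      rw [Real.tan_eq_sin_div_cos, Real.sin_pi_sub, Real.cos_pi_sub]
      have : 1 - 2 * y.1 * Real.cos y.2.1 - 1 ≠ 0 := by nlinarith
      have hc' := hc.ne
      field_simp
      ring
    rw [this, Real.arctan_tan (by linarith [hy.2.1.2, Real.pi_pos]) (by linarith [hy.2.1.1])]
    ring

theorem om_toX : om (toX y).2.1 (toX y).2.2 = 1 - y.2.2 ^ 2 - y.1 * Real.sin y.2.1 / 4 := by
  unfold om
  rw [toX_thd_sq hy]
  change 1 - y.2.2 ^ 2 - _ = _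
  ring

end Coordinates

section Inverse

variable {x : XCoord} (hx : x ∈ region)
include hx

theorem region_sq_sub_one_pos : 0 < x.1 ^ 2 - 1 := by nlinarith [hx.1]

theorem fromX_mem : fromX x ∈ blownRegion := by
  have hk := region_sq_sub_one_pos hx
  have hM : 0 < x.2.2 ^ 2 := pow_pos hx.2.2.2 2
  refine ⟨Real.sqrt_pos.2 (by positivity), ⟨?_, ?_⟩, hx.2.1, hx.2.2.1⟩
  · have := Real.arctan_lt_pi_div_two (2 / 3 * (x.2.2 ^ 2 / (x.1 ^ 2 - 1)))
    dsimp only [fromX]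
    linarith
  · have : 0 < Real.arctan (2 / 3 * (x.2.2 ^ 2 / (x.1 ^ 2 - 1))) :=
      Real.arctan_pos.2 (by positivity)
    dsimp only [fromX]
    linarith

theorem toX_fromX : toX (fromX x) = x := by
  have hk := region_sq_sub_one_pos hx
  have hM : 0 < x.2.2 ^ 2 := pow_pos hx.2.2.2 2
  set k := x.1 ^ 2 - 1 with hkdef
  have hrho : Real.sqrt (1 + (2 / 3 * (x.2.2 ^ 2 / k)) ^ 2)
      = Real.sqrt ((k / 2) ^ 2 + (x.2.2 ^ 2 / 3) ^ 2) / (k / 2) := by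
    rw [eq_div_iff (by positivity), ← Real.sqrt_sq (by positivity : 0 ≤ k / 2),
      ← Real.sqrt_mul (by positivity)]
    congr 1
    rw [Real.sqrt_sq (by positivity)]
    field_simp
  have hpos : 0 < Real.sqrt ((k / 2) ^ 2 + (x.2.2 ^ 2 / 3) ^ 2) := Real.sqrt_pos.2 (by positivity)
  unfold toX fromX
  dsimp only
  rw [← hkdef, Real.cos_pi_sub, Real.sin_pi_sub, Real.cos_arctan, Real.sin_arctan, hrho]
  refine Prod.ext ?_ (Prod.ext rfl ?_)
  · dsimp only
    have : 1 - 2 * Real.sqrt ((k / 2) ^ 2 + (x.2.2 ^ 2 / 3) ^ 2) *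
        -(1 / (Real.sqrt ((k / 2) ^ 2 + (x.2.2 ^ 2 / 3) ^ 2) / (k / 2))) = x.1 ^ 2 := by
      field_simp
      rw [hkdef]
      ring
    rw [this, Real.sqrt_sq (by linarith [hx.1])]
  · dsimp only
    have : 3 * Real.sqrt ((k / 2) ^ 2 + (x.2.2 ^ 2 / 3) ^ 2) *
        (2 / 3 * (x.2.2 ^ 2 / k) / (Real.sqrt ((k / 2) ^ 2 + (x.2.2 ^ 2 / 3) ^ 2) / (k / 2)))
        = x.2.2 ^ 2 := by
      field_simp
    rw [this, Real.sqrt_sq hx.2.2.2.le]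

/-- The values of `s`; it is small where `M₁² / (H_D² - 1)` is. -/
theorem sOf_mem : 0 < sOf x ∧ sOf x < 1 / 2 ∧ sOf x ≤ x.2.2 ^ 2 / (x.1 ^ 2 - 1) := by
  have hk := region_sq_sub_one_pos hx
  have hM : 0 < x.2.2 ^ 2 := pow_pos hx.2.2.2 2
  have hp : 0 < (x.1 ^ 2 - 1) / x.2.2 ^ 2 := by positivity
  have e : sOf x = (2 + 3 * ((x.1 ^ 2 - 1) / x.2.2 ^ 2))⁻¹ := by
    unfold sOf
    congr 1
    ring
  rw [e]
  refine ⟨by positivity, ?_, ?_⟩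
  · rw [one_div]
    exact inv_strictAnti₀ two_pos (by linarith)
  · rw [← inv_div (x.1 ^ 2 - 1)]
    exact inv_anti₀ hp (by linarith)

end Inverse

theorem mem_stateSpace_iff {y : YCoord} :
    y ∈ stateSpace ↔ y ∈ blownRegion ∧ 0 < om (toX y).2.1 (toX y).2.2 := by
  constructor
  · rintro ⟨⟨hr, hr'⟩, hθ, hS⟩
    have hy : y ∈ blownRegion := ⟨hr, hθ, hS⟩
    refine ⟨hy, ?_⟩
    rw [lt_div_iff₀ (sin_pos_of_mem hy)] at hr'
    rw [om_toX hy]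
    linarith
  · rintro ⟨hy, hO⟩
    rw [om_toX hy] at hO
    refine ⟨⟨hy.1, ?_⟩, hy.2⟩
    rw [lt_div_iff₀ (sin_pos_of_mem hy)]
    linarith

theorem mem_vacuumSpace_iff {y : YCoord} :
    y ∈ vacuumSpace ↔ y ∈ blownRegion ∧ om (toX y).2.1 (toX y).2.2 = 0 := by
  constructor
  · rintro ⟨hr, hθ, hS⟩
    have hs : 0 < Real.sin y.2.1 :=
      Real.sin_pos_of_pos_of_lt_pi (by linarith [hθ.1, Real.pi_pos]) hθ.2
    have hy : y ∈ blownRegion := by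
      refine ⟨?_, hθ, hS⟩
      rw [hr]
      have : 0 < 1 - y.2.2 ^ 2 := by nlinarith [hS.1, hS.2]
      positivity
    refine ⟨hy, ?_⟩
    rw [eq_div_iff hs.ne'] at hr
    rw [om_toX hy]
    linarith
  · rintro ⟨hy, hO⟩
    rw [om_toX hy] at hO
    refine ⟨?_, hy.2⟩
    rw [eq_div_iff (sin_pos_of_mem hy).ne']
    linarith

theorem field_eq (w : ℝ) (w₂ : ℝ → ℝ) (x : XCoord) :
    field w w₂ x = (rateH w x.1 x.2.1 x.2.2, rateS w (w₂ (sOf x) - w) x.1 x.2.1 x.2.2,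
      rateM w x.1 x.2.1 x.2.2) := by
  unfold field rateH rateS rateM
  have hO : Omega x = om x.2.1 x.2.2 := rfl
  have hq : decel w x = dec w x.2.1 x.2.2 := rfl
  simp only [hO, hq]
  refine Prod.ext ?_ (Prod.ext ?_ ?_) <;> dsimp only <;> ring

/-- In vacuum, the matter model drops out of the equations. -/
theorem field_eq_of_om_eq_zero (w : ℝ) (w₂ : ℝ → ℝ) {x : XCoord} (hx : om x.2.1 x.2.2 = 0) :
    field w w₂ x = field 0 (perfectFluid 0) x := by
  rw [field_eq, field_eq]
  unfold rateH rateS rateM dec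
  simp [hx]

theorem contDiffOn_field {w : ℝ} {w₂ : ℝ → ℝ} (hw₂ : ContDiffOn ℝ 1 w₂ (Icc 0 (1 / 2))) :
    ContDiffOn ℝ 1 (field w w₂) region := by
  have hs : ContDiffOn ℝ 1 sOf region := by
    unfold sOf
    have h0 : ∀ x ∈ region, x.2.2 ^ 2 ≠ 0 := fun x hx => (pow_pos hx.2.2.2 2).ne'
    refine ContDiffOn.inv ?_ fun x hx => ?_
    · refine contDiffOn_const.sub (contDiffOn_const.mul (ContDiffOn.div ?_ ?_ h0)) <;> fun_prop
    · have := (sOf_mem hx).1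
      unfold sOf at this
      exact (inv_pos.1 this).ne'
  have hws : ContDiffOn ℝ 1 (fun x => w₂ (sOf x)) region :=
    hw₂.comp hs fun x hx => ⟨(sOf_mem hx).1.le, (sOf_mem hx).2.1.le⟩
  have : field w w₂ = fun x => (rateH w x.1 x.2.1 x.2.2,
      rateS w (w₂ (sOf x) - w) x.1 x.2.1 x.2.2, rateM w x.1 x.2.1 x.2.2) :=
    funext (field_eq w w₂)
  rw [this]
  have key : ∀ g : XCoord → ℝ, ContDiffOn ℝ 1 g region → ContDiffOn ℝ 1 (fun x : XCoord =>
      (rateH w x.1 x.2.1 x.2.2, rateS w (g x - w) x.1 x.2.1 x.2.2, rateM w x.1 x.2.1 x.2.2))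
      region := fun g hg => by
    unfold rateH rateS rateM dec om
    fun_prop
  exact key _ hws

theorem isOrbit_of_isIntegralCurveOn {w : ℝ} {w₂ : ℝ → ℝ} {x : ℝ → XCoord} {I : Set ℝ}
    (hx : IsIntegralCurveOn x (fun _ => field w w₂) I) (hr : ∀ t ∈ I, x t ∈ region)
    (hO : ∀ t ∈ I, 0 ≤ om (x t).2.1 (x t).2.2) :
    IsOrbit w (fun t => w₂ (sOf (x t)) - w) (fun t => (x t).1) (fun t => (x t).2.1)
      (fun t => (x t).2.2) I := by
  have h : ∀ t ∈ I, HasDerivWithinAt x _ I t := fun t ht =>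
    (hx t ht).congr_deriv (field_eq w w₂ (x t))
  exact {
    one_lt := fun t ht => (hr t ht).1
    neg_one_lt := fun t ht => (hr t ht).2.1
    lt_one := fun t ht => (hr t ht).2.2.1
    pos := fun t ht => (hr t ht).2.2.2
    om_nonneg := hO
    deriv_H := fun t ht => (h t ht).fst
    deriv_S := fun t ht => (h t ht).snd.fst
    deriv_M := fun t ht => (h t ht).snd.snd }

theorem exists_abs_sub_le {w : ℝ} {w₂ : ℝ → ℝ} (hw₂ : ContDiffOn ℝ 1 w₂ (Icc 0 (1 / 2))) :
    ∃ K, 0 ≤ K ∧ ∀ x ∈ region, |w₂ (sOf x) - w| ≤ K := by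
  obtain ⟨K, hK⟩ := isCompact_Icc.exists_bound_of_continuousOn
    (hw₂.continuousOn.sub (continuousOn_const (c := w)))
  exact ⟨|K|, abs_nonneg _, fun x hx =>
    (hK (sOf x) ⟨(sOf_mem hx).1.le, (sOf_mem hx).2.1.le⟩).trans (le_abs_self K)⟩

theorem box_subset_region {ε δ b : ℝ} (hε : 0 < ε) (hδ : 0 ≤ δ) : box ε δ b ⊆ region := by
  rintro x ⟨h1, -, -, -, h5, -, h7⟩
  unfold om at h7
  have hM : 0 < x.2.2 := by linarith
  have : x.2.1 ^ 2 < 1 := by nlinarith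
  exact ⟨by linarith, by nlinarith, by nlinarith, hM⟩

theorem exists_isSolution_stateSpace {w : ℝ} (hw : -1 / 3 < w) (hw1 : w < 1) {w₂ : ℝ → ℝ}
    (hw₂ : ContDiffOn ℝ 1 w₂ (Icc 0 (1 / 2))) {y : YCoord} (hy : y ∈ stateSpace) :
    ∃ γ, IsSolution w w₂ stateSpace y γ := by
  obtain ⟨hyb, hyO⟩ := mem_stateSpace_iff.1 hy
  have hx₀ := toX_mem_region hyb
  obtain ⟨K, hK0, hK⟩ := exists_abs_sub_le (w := w) hw₂
  have hU : IsOpen (region ∩ {x | 0 < om x.2.1 x.2.2}) :=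
    isOpen_region.inter (isOpen_lt continuous_const continuous_om)
  obtain ⟨x, hx0, hxU, hx⟩ := exists_isIntegralCurveOn_Ici hU
    ((contDiffOn_field (w := w) hw₂).mono inter_subset_left) (x₀ := toX y) ⟨hx₀, hyO⟩
    fun T _ => by
      obtain ⟨ε, b, c, hε, hc, hbox⟩ := exists_mem_box hw hw1 hK0 (T := T) hx₀.1 hx₀.2.1 hx₀.2.2.2
      have hδ : 0 < c * om (toX y).2.1 (toX y).2.2 := mul_pos hc hyO
      refine ⟨box ε (c * om (toX y).2.1 (toX y).2.2) b, isCompact_box _ _ _, fun z hz =>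
        ⟨box_subset_region hε hδ.le hz, hδ.trans_le hz.2.2.2.2.2.2⟩, fun t ht x hx0 hxU hx => ?_⟩
      have horb := isOrbit_of_isIntegralCurveOn hx (fun s hs => (hxU s hs).1)
        (fun s hs => (hxU s hs).2.le)
      obtain ⟨⟨b1, b2, b3, b4, b5, b6, -⟩, h2⟩ := hbox _ _ _ _ t ht horb
        (fun s hs => hK _ (hxU s hs).1) (by rw [hx0]) (by rw [hx0]) (by rw [hx0])
      exact ⟨b1, b2, b3, b4, b5, b6, h2 fun s hs => (hxU s hs).2⟩
  refine ⟨fun t => fromX (x t), by rw [hx0, fromX_toX hyb], fun t ht => ?_, fun t ht => ?_⟩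
  · rw [mem_stateSpace_iff, toX_fromX (hxU t ht).1]
    exact ⟨fromX_mem (hxU t ht).1, (hxU t ht).2⟩
  · dsimp only
    rw [toX_fromX (hxU t ht).1]
    exact (hx t ht).congr (fun s hs => toX_fromX (hxU s hs).1) (toX_fromX (hxU t ht).1)

theorem exists_isSolution_vacuumSpace (w : ℝ) (w₂ : ℝ → ℝ) {y : YCoord} (hy : y ∈ vacuumSpace) :
    ∃ γ, IsSolution w w₂ vacuumSpace y γ := by
  obtain ⟨hyb, hyO⟩ := mem_vacuumSpace_iff.1 hy
  have hx₀ := toX_mem_region hyb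
  have hw₂ : ContDiffOn ℝ 1 (perfectFluid 0) (Icc 0 (1 / 2)) := contDiffOn_const
  -- the vacuum boundary is invariant under the flow
  have hvac : ∀ t, ∀ x : ℝ → XCoord, x 0 = toX y → (∀ s ∈ Icc 0 t, x s ∈ region) →
      (∀ s ∈ Icc 0 t, HasDerivWithinAt x (field 0 (perfectFluid 0) (x s)) (Icc 0 t) s) →
      ∀ s ∈ Icc 0 t, om (x s).2.1 (x s).2.2 = 0 := fun t x hx0 hxU hx => by
    have hxc : ContinuousOn x (Icc 0 t) := fun s hs => (hx s hs).continuousWithinAt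
    have hd : ∀ s ∈ Icc 0 t, HasDerivWithinAt x _ (Icc 0 t) s :=
      fun s hs => field_eq 0 (perfectFluid 0) (x s) ▸ hx s hs
    have hom : ∀ s ∈ Icc 0 t, HasDerivWithinAt (fun s => om (x s).2.1 (x s).2.2) _ (Icc 0 t) s :=
      fun s hs => hasDerivWithinAt_om_of_rate (hd s hs).snd.fst (hd s hs).snd.snd
    have hg : ContinuousOn (fun s => (2 * dec 0 (x s).2.1 (x s).2.2 - (1 + 3 * 0)) * (x s).1
        - 2 * ((x s).1 ^ 2 - 1) * (x s).2.1
        - 6 * (x s).2.1 * (perfectFluid 0 (sOf (x s)) - 0)) (Icc 0 t) := by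
      unfold dec om perfectFluid
      fun_prop
    obtain ⟨C, hC⟩ := isCompact_Icc.exists_bound_of_continuousOn hg
    refine eq_zero_of_abs_deriv_le_mul_abs_self_of_eq_zero_right (K := C)
      (fun s hs => (hom s hs).continuousWithinAt)
      (fun s hs => (hom s (Ico_subset_Icc_self hs)).mono_of_mem_nhdsWithin
        (mem_of_superset (Icc_mem_nhdsGE hs.2) (Icc_subset_Icc_left hs.1)))
      (by rw [hx0, hyO]) fun s hs => ?_
    rw [norm_mul, mul_comm]
    exact mul_le_mul_of_nonneg_right (hC s (Ico_subset_Icc_self hs)) (norm_nonneg _)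
  obtain ⟨x, hx0, hxU, hx⟩ := exists_isIntegralCurveOn_Ici isOpen_region
    (contDiffOn_field (w := 0) hw₂) hx₀ fun T _ => by
      obtain ⟨ε, b, c, hε, hc, hbox⟩ := exists_mem_box (w := 0) (by norm_num) one_pos le_rfl
        (T := T) hx₀.1 hx₀.2.1 hx₀.2.2.2
      refine ⟨box ε 0 b, isCompact_box _ _ _, box_subset_region hε le_rfl,
        fun t ht x hx0 hxU hx => ?_⟩
      have horb := isOrbit_of_isIntegralCurveOn hx hxU
        (fun s hs => (hvac t x hx0 hxU hx s hs).ge)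
      exact (hbox _ _ _ _ t ht horb (fun s hs => by simp [perfectFluid]) (by rw [hx0])
        (by rw [hx0]) (by rw [hx0])).1
  have hxO : ∀ t ∈ Ici (0 : ℝ), om (x t).2.1 (x t).2.2 = 0 := fun t ht =>
    hvac t x hx0 (fun s hs => hxU s hs.1)
      (fun s hs => (hx s hs.1).mono Icc_subset_Ici_self) t ⟨ht, le_rfl⟩
  refine ⟨fun t => fromX (x t), by rw [hx0, fromX_toX hyb], fun t ht => ?_, fun t ht => ?_⟩
  · rw [mem_vacuumSpace_iff, toX_fromX (hxU t ht)]
    exact ⟨fromX_mem (hxU t ht), hxO t ht⟩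
  · dsimp only
    rw [toX_fromX (hxU t ht), field_eq_of_om_eq_zero w w₂ (hxO t ht)]
    exact (hx t ht).congr (fun s hs => toX_fromX (hxU s hs)) (toX_fromX (hxU t ht))

/-- Convergence to a point with `M₁ = 0`: as `θ` depends on the quotient `M₁² / (H_D² - 1)`, this
has to tend to `0` as well. -/
theorem tendsto_typeIIIPoint {γ : ℝ → YCoord} (hγ : ∀ t ∈ Ici (0 : ℝ), γ t ∈ blownRegion)
    {H S : ℝ} (hH1 : 1 ≤ H) (hH : Tendsto (fun t => (toX (γ t)).1) atTop (𝓝 H))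
    (hS : Tendsto (fun t => (toX (γ t)).2.1) atTop (𝓝 S))
    (hM : Tendsto (fun t => (toX (γ t)).2.2 ^ 2) atTop (𝓝 0))
    (hMk : Tendsto (fun t => (toX (γ t)).2.2 ^ 2 / ((toX (γ t)).1 ^ 2 - 1)) atTop (𝓝 0)) :
    Tendsto γ atTop (𝓝 (typeIIIPoint H S)) := by
  have hlim : Tendsto (fun t => fromX (toX (γ t))) atTop (𝓝 (typeIIIPoint H S)) := by
    refine Tendsto.prodMk_nhds ?_ (Tendsto.prodMk_nhds ?_ hS)
    · have h1 := ((((hH.pow 2).sub_const 1).div_const 2).pow 2).add ((hM.div_const 3).pow 2)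
      have h2 := h1.sqrt
      have e : Real.sqrt (((H ^ 2 - 1) / 2) ^ 2 + (0 / 3) ^ 2) = (H ^ 2 - 1) / 2 := by
        rw [zero_div, zero_pow two_ne_zero, add_zero, Real.sqrt_sq (by nlinarith)]
      rwa [e] at h2
    · have h1 := (Real.continuous_arctan.tendsto _).comp (hMk.const_mul (2 / 3))
      have h2 := h1.const_sub Real.pi
      simpa using h2
  refine hlim.congr' ?_
  filter_upwards [eventually_ge_atTop (0 : ℝ)] with t ht
  exact fromX_toX (hγ t ht)

theorem isOpen_stateSpace : IsOpen stateSpace := by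
  have : stateSpace = {y : YCoord | (0 < y.1 ∧ (Real.pi / 2 < y.2.1 ∧ y.2.1 < Real.pi) ∧
      (-1 < y.2.2 ∧ y.2.2 < 1)) ∧ 0 < 1 - y.2.2 ^ 2 - y.1 * Real.sin y.2.1 / 4} := by
    ext y
    rw [mem_stateSpace_iff]
    constructor
    · rintro ⟨hy, hO⟩
      exact ⟨hy, om_toX hy ▸ hO⟩
    · rintro ⟨hy, hO⟩
      exact ⟨hy, (om_toX (y := y) hy).symm ▸ hO⟩
  rw [this]
  simp only [ofPred_and]
  refine IsOpen.inter ((isOpen_lt ?_ ?_).inter <| ((isOpen_lt ?_ ?_).inter (isOpen_lt ?_ ?_)).inter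
    ((isOpen_lt ?_ ?_).inter (isOpen_lt ?_ ?_))) (isOpen_lt ?_ ?_) <;> fun_prop

theorem generically_of_forall {Q : YCoord → Prop} (h : ∀ y ∈ stateSpace, Q y) :
    Generically Q :=
  ⟨stateSpace, subset_rfl, isOpen_stateSpace, subset_closure, by simp, h⟩

/-! ### Asymptotic properties shared by all orbits -/

namespace IsOrbit

variable {w K : ℝ} {κ H S M : ℝ → ℝ}

section Pointwise

variable {I : Set ℝ} (h : IsOrbit w κ H S M I) {t : ℝ} (ht : t ∈ I) (hκ : |κ t| ≤ K)
include h ht hκ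

theorem abs_om_mul_le : |om (S t) (M t) * κ t| ≤ K * om (S t) (M t) := by
  rw [abs_mul, abs_of_nonneg (h.om_nonneg t ht), mul_comm]
  exact mul_le_mul_of_nonneg_right hκ (h.om_nonneg t ht)

variable (hw : -1 / 3 < w) (hw1 : w < 1)
include hw hw1

/-- The derivative of `S / H²` is bounded below by a positive constant where `H` is large. -/
theorem rate_S_div_sq_ge : 1 - (7 + 3 * K) / H t ≤
    rateS w (κ t) (H t) (S t) (M t) / H t ^ 2
      - 2 * S t * rateH w (H t) (S t) (M t) / H t ^ 3 := by
  have h1 := h.one_lt t ht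
  have hk := h.sq_sub_one_pos ht
  have hO := h.om_nonneg t ht
  have hS := abs_le.1 (h.abs_S_le ht)
  have hK : 0 ≤ K := (abs_nonneg _).trans hκ
  have hq0 := dec_nonneg (S := S t) (M := M t) hw hO
  have hq2 := dec_le_two (S := S t) (M := M t) hw1 hO
  have hO1 : om (S t) (M t) ≤ 1 := om_le.trans (by nlinarith [sq_nonneg (S t)])
  have hOκ := (abs_le.1 (h.abs_om_mul_le ht hκ)).1
  have hlow : -(2 * H t) + (H t ^ 2 - 1) * (1 - S t ^ 2) - 3 * K
      ≤ rateS w (κ t) (H t) (S t) (M t) := by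
    have : (2 - dec w (S t) (M t)) * (H t * S t) ≤ 2 * H t := by
      have : H t * S t ≤ H t := by nlinarith
      nlinarith
    unfold rateS
    nlinarith [sq_nonneg (M t)]
  have hq : S t * dec w (S t) (M t) ≤ 2 := by nlinarith
  have e : rateS w (κ t) (H t) (S t) (M t) / H t ^ 2
      - 2 * S t * rateH w (H t) (S t) (M t) / H t ^ 3 - (1 - (7 + 3 * K) / H t)
      = (rateS w (κ t) (H t) (S t) (M t) * H t - 2 * S t * rateH w (H t) (S t) (M t)
        - H t ^ 3 + (7 + 3 * K) * H t ^ 2) / H t ^ 3 := by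
    field_simp
    ring
  rw [← sub_nonneg, e]
  refine div_nonneg ?_ (by positivity)
  have h2 := mul_le_mul_of_nonneg_right hlow (by linarith : 0 ≤ H t)
  have h3 := mul_le_mul_of_nonneg_left hq hk.le
  unfold rateH
  nlinarith [mul_nonneg (mul_nonneg hK (by linarith : 0 ≤ H t)) (by linarith : 0 ≤ H t - 1),
    mul_nonneg (mul_nonneg (by linarith : 0 ≤ H t) hk.le) (sq_nonneg (S t))]

/-- The derivative of `S / H³` is bounded below by a positive multiple of `1 / H`, up to a multiple
of `q / H`. -/
theorem rate_S_div_cube_ge :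
    1 / (2 * H t) - (6 + (4 + 3 * K) / ((1 + 3 * w) / 2)) * (dec w (S t) (M t) / H t) ≤
    rateS w (κ t) (H t) (S t) (M t) / H t ^ 3
      - 3 * S t * rateH w (H t) (S t) (M t) / H t ^ 4 := by
  have h1 := h.one_lt t ht
  have hk := h.sq_sub_one_pos ht
  have hO := h.om_nonneg t ht
  have hS := abs_le.1 (h.abs_S_le ht)
  have hK : 0 ≤ K := (abs_nonneg _).trans hκ
  have hq0 := dec_nonneg (S := S t) (M := M t) hw hO
  have hq2 := dec_le_two (S := S t) (M := M t) hw1 hO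
  have hOκ := (abs_le.1 (h.abs_om_mul_le ht hκ)).1
  have hν : 0 < (1 + 3 * w) / 2 := by linarith
  set q := dec w (S t) (M t) with hq
  have hS2 : 2 * S t ^ 2 ≤ q := by
    rw [hq]
    unfold dec
    nlinarith [mul_nonneg hν.le hO]
  have hOq : (4 + 3 * K) * om (S t) (M t) ≤ (4 + 3 * K) / ((1 + 3 * w) / 2) * q := by
    rw [div_mul_eq_mul_div, le_div_iff₀ hν, mul_assoc]
    refine mul_le_mul_of_nonneg_left ?_ (by positivity)
    rw [hq]
    unfold dec
    nlinarith [sq_nonneg (S t)]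
  set D := (4 + 3 * K) / ((1 + 3 * w) / 2) with hD
  have hD0 : 0 ≤ D := by positivity
  have hlow : -(H t / 2 + 2 * H t * S t ^ 2) + (H t ^ 2 - 1) * (1 - S t ^ 2) + 4 - 2 * q - D * q
      ≤ rateS w (κ t) (H t) (S t) (M t) := by
    have i1 : (2 - q) * (H t * S t) ≤ H t / 2 + 2 * H t * S t ^ 2 := by
      have : (2 - q) * S t ≤ 1 / 2 + 2 * S t ^ 2 := by
        nlinarith [sq_nonneg (2 * S t - (2 - q) / 2), mul_nonneg hq0 (sub_nonneg.2 hq2)]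
      nlinarith
    have i2 : M t ^ 2 / 3 = 4 * (1 - S t ^ 2 - om (S t) (M t)) := by
      unfold om
      ring
    unfold rateS
    rw [i2, ← hq]
    nlinarith
  have hSq : S t * q ≤ q := by nlinarith
  have e : rateS w (κ t) (H t) (S t) (M t) / H t ^ 3
      - 3 * S t * rateH w (H t) (S t) (M t) / H t ^ 4 - (1 / (2 * H t) - (6 + D) * (q / H t))
      = (rateS w (κ t) (H t) (S t) (M t) * H t - 3 * S t * rateH w (H t) (S t) (M t)
        - H t ^ 3 / 2 + (6 + D) * q * H t ^ 3) / H t ^ 4 := by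
    field_simp
    ring
  rw [← sub_nonneg, e]
  refine div_nonneg ?_ (by positivity)
  have h2 := mul_le_mul_of_nonneg_right hlow (by linarith : 0 ≤ H t)
  have h3 := mul_le_mul_of_nonneg_left hSq hk.le
  have hH2 : 1 ≤ H t ^ 2 := by nlinarith
  have hH3 : H t ≤ H t ^ 3 := by nlinarith
  have hH23 : H t ^ 2 ≤ H t ^ 3 := by nlinarith
  have j1 : D * q * H t ≤ D * q * H t ^ 3 :=
    mul_le_mul_of_nonneg_left hH3 (mul_nonneg hD0 hq0)
  have j2 : q * H t ≤ q * H t ^ 3 := mul_le_mul_of_nonneg_left hH3 hq0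
  have j3 : q * H t ^ 2 ≤ q * H t ^ 3 := mul_le_mul_of_nonneg_left hH23 hq0
  have j4 : H t ^ 2 * (2 * S t ^ 2) ≤ H t ^ 2 * q := mul_le_mul_of_nonneg_left hS2 (sq_nonneg _)
  have j5 : 0 ≤ H t * (H t ^ 2 - 1) * S t ^ 2 := by positivity
  unfold rateH
  rw [← hq]
  nlinarith

end Pointwise

/-- `M₁² / (H_D² - 1)`, which governs `s`, decays exponentially, whatever the matter model: the
function `(1 - H⁻²)³ (H² - 1) / M²` has logarithmic derivative `6 q / H ≥ 0`, and the derivatives of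
the bounded functions `S / H²` and `S / H³` show that this is not integrable in time. -/
theorem exists_sq_div_le (h : IsOrbit w κ H S M (Ici 0)) (hw : -1 / 3 < w) (hw1 : w < 1)
    (hκ : ∀ t ∈ Ici (0 : ℝ), |κ t| ≤ K) :
    ∃ c C : ℝ, 0 < c ∧ 0 < C ∧ ∀ t ∈ Ici (0 : ℝ),
      M t ^ 2 / (H t ^ 2 - 1) ≤ C * Real.exp (-c * t) := by
  have hK : 0 ≤ K := (abs_nonneg _).trans (hκ 0 self_mem_Ici)
  have hν : 0 < (1 + 3 * w) / 2 := by linarith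
  set D := 6 + (4 + 3 * K) / ((1 + 3 * w) / 2) with hD
  have hD0 : 0 < D := by positivity
  set A := 7 + 3 * K with hA
  have hA0 : 0 < A := by positivity
  have hz : ∀ t ∈ Ici (0 : ℝ), HasDerivWithinAt (fun t =>
      D / 6 * (4 * Real.log (H t ^ 2 - 1) - 6 * Real.log (H t) - 2 * Real.log (M t))
        + S t / H t ^ 3 + 1 / (2 * A) * (S t / H t ^ 2))
      (D * (dec w (S t) (M t) / H t)
        + (rateS w (κ t) (H t) (S t) (M t) / H t ^ 3
          - 3 * S t * rateH w (H t) (S t) (M t) / H t ^ 4)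
        + 1 / (2 * A) * (rateS w (κ t) (H t) (S t) (M t) / H t ^ 2
          - 2 * S t * rateH w (H t) (S t) (M t) / H t ^ 3)) (Ici 0) t := fun t ht => by
    have hH : H t ≠ 0 := by linarith [h.one_lt t ht]
    have d1 := (((h.hasDerivWithinAt_log_sq_sub_one ht).const_mul 4).sub
      ((h.hasDerivWithinAt_log_H ht).const_mul 6)).sub
      ((h.hasDerivWithinAt_log_M ht).const_mul 2)
    have d2 := (h.deriv_S t ht).fun_div ((h.deriv_H t ht).fun_pow 3) (pow_ne_zero 3 hH)
    have d3 := (h.deriv_S t ht).fun_div ((h.deriv_H t ht).fun_pow 2) (pow_ne_zero 2 hH)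
    refine (((d1.const_mul (D / 6)).add d2).add (d3.const_mul (1 / (2 * A)))).congr_deriv ?_
    generalize rateS w (κ t) (H t) (S t) (M t) = rS
    generalize rateH w (H t) (S t) (M t) = rH
    generalize dec w (S t) (M t) = q
    field_simp
    push_cast
    ring
  refine ⟨1 / (2 * A) * (6 / D), Real.exp (6 / D * (1 + 1 / (2 * A) -
    (D / 6 * (4 * Real.log (H 0 ^ 2 - 1) - 6 * Real.log (H 0) - 2 * Real.log (M 0))
        + S 0 / H 0 ^ 3 + 1 / (2 * A) * (S 0 / H 0 ^ 2)))), by positivity, Real.exp_pos _,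
    fun t ht => ?_⟩
  have h1 := mul_sub_le_sub_of_le_derivWithin hz ht (Icc_subset_Ici_zero le_rfl)
    (c := 1 / (2 * A)) fun u hu => by
      have a1 := h.rate_S_div_sq_ge (t := u) hu.1 (hκ u hu.1) hw hw1
      have a2 := h.rate_S_div_cube_ge (t := u) hu.1 (hκ u hu.1) hw hw1
      have hH := h.one_lt u hu.1
      have a3 := mul_le_mul_of_nonneg_left a1 (by positivity : 0 ≤ 1 / (2 * A))
      have a4 : 1 / (2 * A) * (1 - A / H u) = 1 / (2 * A) - 1 / (2 * H u) := by
        field_simp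
      rw [← hA, a4] at a3
      rw [← hD] at a2
      linarith
  have hH := h.one_lt t ht
  have hk := h.sq_sub_one_pos ht
  have hM := h.pos t ht
  have hS := abs_le.1 (h.abs_S_le ht)
  have b1 : S t / H t ^ 3 ≤ 1 := by
    rw [div_le_one (by positivity)]
    exact hS.2.trans (one_le_pow₀ hH.le)
  have b2 : S t / H t ^ 2 ≤ 1 := by
    rw [div_le_one (by positivity)]
    exact hS.2.trans (one_le_pow₀ hH.le)
  have b2' := mul_le_mul_of_nonneg_left b2 (by positivity : 0 ≤ 1 / (2 * A))
  have b3 := h.log_sq_sub_one_le ht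
  rw [← Real.exp_add, ← Real.log_le_iff_le_exp (by positivity), Real.log_div (by positivity) hk.ne',
    Real.log_pow]
  set E := D / 6 * (4 * Real.log (H 0 ^ 2 - 1) - 6 * Real.log (H 0) - 2 * Real.log (M 0))
        + S 0 / H 0 ^ 3 + 1 / (2 * A) * (S 0 / H 0 ^ 2)
  have b4 : 1 / (2 * A) * t + E - 1 - 1 / (2 * A) ≤
      D / 6 * (Real.log (H t ^ 2 - 1) - 2 * Real.log (M t)) := by
    have : D / 6 * (4 * Real.log (H t ^ 2 - 1) - 6 * Real.log (H t) - 2 * Real.log (M t)) ≤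
        D / 6 * (Real.log (H t ^ 2 - 1) - 2 * Real.log (M t)) :=
      mul_le_mul_of_nonneg_left (by linarith) (by positivity)
    linarith
  have b5 := mul_le_mul_of_nonneg_left b4 (by positivity : 0 ≤ 6 / D)
  have b6 : 6 / D * (D / 6 * (Real.log (H t ^ 2 - 1) - 2 * Real.log (M t))) =
      Real.log (H t ^ 2 - 1) - 2 * Real.log (M t) := by
    field_simp
  rw [b6] at b5
  push_cast
  linarith

variable (h : IsOrbit w κ H S M (Ici 0))
include h

theorem tendsto_sq_div (hw : -1 / 3 < w) (hw1 : w < 1) (hκ : ∀ t ∈ Ici (0 : ℝ), |κ t| ≤ K) :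
    Tendsto (fun t => M t ^ 2 / (H t ^ 2 - 1)) atTop (𝓝 0) := by
  obtain ⟨c, C, hc, -, hle⟩ := h.exists_sq_div_le hw hw1 hκ
  refine squeeze_zero' ?_ ?_ (tendsto_const_mul_exp_neg C hc)
  · filter_upwards [eventually_ge_atTop (0 : ℝ)] with t ht
    exact div_nonneg (sq_nonneg _) (h.sq_sub_one_pos ht).le
  · filter_upwards [eventually_ge_atTop (0 : ℝ)] with t ht
    exact hle t ht

theorem tendsto_M_sq (hw : -1 / 3 < w) (hw1 : w < 1) (hκ : ∀ t ∈ Ici (0 : ℝ), |κ t| ≤ K)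
    {B : ℝ} (hB : ∀ t ∈ Ici (0 : ℝ), H t ≤ B) : Tendsto (fun t => M t ^ 2) atTop (𝓝 0) := by
  have h1 := (h.tendsto_sq_div hw hw1 hκ).mul_const (B ^ 2)
  rw [zero_mul] at h1
  refine squeeze_zero' (Eventually.of_forall fun t => sq_nonneg _) ?_ h1
  filter_upwards [eventually_ge_atTop (0 : ℝ)] with t ht
  have hk := h.sq_sub_one_pos ht
  have h2 := h.one_lt t ht
  calc M t ^ 2 = M t ^ 2 / (H t ^ 2 - 1) * (H t ^ 2 - 1) := (div_mul_cancel₀ _ hk.ne').symm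
    _ ≤ M t ^ 2 / (H t ^ 2 - 1) * B ^ 2 := by
      refine mul_le_mul_of_nonneg_left ?_ (div_nonneg (sq_nonneg _) hk.le)
      nlinarith [hB t ht]

/-- If `Σ₊` increases at a rate of at least `c (1 - Σ₊²)` below `b`, then `log (1 + Σ₊)` increases
at a definite rate there, and `Σ₊` ends up above `b`. -/
theorem eventually_le_S {b c : ℝ} (hc : 0 < c) (hb : -1 < b) (hb2 : b ≤ 1 / 2)
    (hr : ∀ᶠ t in atTop, S t ≤ b → (1 - S t ^ 2) * c ≤ rateS w (κ t) (H t) (S t) (M t)) :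
    ∀ᶠ t in atTop, b ≤ S t := by
  have hd : ∀ t ∈ Ici (0 : ℝ), HasDerivWithinAt (fun t => Real.log (1 + S t)) _ (Ici 0) t :=
    fun t ht => ((h.deriv_S t ht).const_add 1).log (by linarith [h.neg_one_lt t ht])
  have := eventually_ge_of_le_deriv hd (b := Real.log (1 + b)) (c := c / 2) (by positivity) (by
    filter_upwards [hr, eventually_ge_atTop (0 : ℝ)] with t ht ht0 hle
    have h1 := h.neg_one_lt t ht0
    rw [Real.log_le_log_iff (by linarith) (by linarith)] at hle
    have hle' : S t ≤ b := by linarith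
    rw [le_div_iff₀ (by linarith)]
    refine le_trans ?_ (ht hle')
    nlinarith [mul_nonneg hc.le (by linarith : 0 ≤ 1 + S t)])
  filter_upwards [this, eventually_ge_atTop (0 : ℝ)] with t ht ht0
  have h1 := h.neg_one_lt t ht0
  rw [Real.log_le_log_iff (by linarith) (by linarith)] at ht
  linarith

/-- If `Σ₊` stays above a positive constant, then `H` decreases where it is large. -/
theorem exists_H_le (hw1 : w < 1) {b : ℝ} (hb : 0 < b) (hS : ∀ᶠ t in atTop, b ≤ S t) :
    ∃ B, ∀ t ∈ Ici (0 : ℝ), H t ≤ B := by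
  have h1 : ∀ᶠ t in atTop, H t ≤ max 2 (3 / b) := by
    refine eventually_le_of_deriv_le h.deriv_H one_pos ?_
    filter_upwards [hS, eventually_ge_atTop (0 : ℝ)] with t ht ht0 hle
    have h2 : 3 / b ≤ H t := (le_max_right _ _).trans hle
    have h3 : 2 ≤ H t := (le_max_left _ _).trans hle
    rw [div_le_iff₀ hb] at h2
    have h4 := dec_le_two (S := S t) (M := M t) hw1 (h.om_nonneg t ht0)
    have h5 : dec w (S t) (M t) - H t * S t ≤ -1 := by nlinarith
    have h6 := mul_le_mul_of_nonneg_left h5 (by nlinarith : 0 ≤ H t ^ 2 - 1)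
    unfold rateH
    nlinarith
  obtain ⟨T, hT⟩ := eventually_atTop.1 h1
  obtain ⟨B, hB⟩ := isCompact_Icc.exists_bound_of_continuousOn (s := Icc 0 T) (f := H)
    fun t ht => (h.deriv_H t ht.1).continuousWithinAt.mono Icc_subset_Ici_self
  refine ⟨max B (max 2 (3 / b)), fun t ht => ?_⟩
  rcases le_total T t with htT | htT
  · exact (hT t htT).trans (le_max_right _ _)
  · exact ((le_abs_self _).trans (hB t ⟨ht, htT⟩)).trans (le_max_left _ _)

theorem uniformContinuousOn_comp (hw : -1 / 3 < w) (hw1 : w < 1)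
    (hκ : ∀ t ∈ Ici (0 : ℝ), |κ t| ≤ K) {B : ℝ} (hB : ∀ t ∈ Ici (0 : ℝ), H t ≤ B)
    {g : ℝ × ℝ × ℝ → ℝ} (hg : Continuous g) :
    UniformContinuousOn (fun t => g (H t, S t, M t)) (Ici 0) := by
  have hK : 0 ≤ K := (abs_nonneg _).trans (hκ 0 self_mem_Ici)
  have hB1 : 1 < B := (h.one_lt 0 self_mem_Ici).trans_le (hB 0 self_mem_Ici)
  have habs : ∀ t ∈ Ici (0 : ℝ), 1 < H t ∧ 0 ≤ H t ^ 2 - 1 ∧ H t ^ 2 - 1 ≤ B ^ 2 ∧ -1 ≤ S t ∧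
      S t ≤ 1 ∧ 0 < M t ∧ M t < 4 ∧ |dec w (S t) (M t)| ≤ 2 := fun t ht =>
    ⟨h.one_lt t ht, (h.sq_sub_one_pos ht).le, by nlinarith [h.one_lt t ht, hB t ht],
      (h.neg_one_lt t ht).le, (h.lt_one t ht).le, h.pos t ht, h.M_lt_four ht,
      abs_le.2 ⟨by linarith [dec_nonneg (S := S t) (M := M t) hw (h.om_nonneg t ht)],
        dec_le_two hw1 (h.om_nonneg t ht)⟩⟩
  have hq : ∀ t ∈ Ici (0 : ℝ), |dec w (S t) (M t) - H t * S t| ≤ 2 + B := fun t ht => by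
    obtain ⟨h1, -, -, -, -, -, -, h8⟩ := habs t ht
    refine (abs_sub _ _).trans (add_le_add h8 ?_)
    rw [abs_mul, abs_of_pos (by linarith)]
    nlinarith [h.abs_S_le ht, hB t ht, abs_nonneg (S t)]
  refine uniformContinuousOn_comp₃
    (uniformContinuousOn_of_deriv_bounded h.deriv_H (C := B ^ 2 * (2 + B)) fun t ht => ?_)
    (uniformContinuousOn_of_deriv_bounded h.deriv_S
      (C := 4 * B + B ^ 2 + 16 / 3 + 3 * K) fun t ht => ?_)
    (uniformContinuousOn_of_deriv_bounded h.deriv_M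
      (C := 4 * (2 * B + 4 + B ^ 2)) fun t ht => ?_) (B := B + 4)
    (fun t ht => ?_) (fun t ht => ?_) (fun t ht => ?_) hg
  · obtain ⟨h1, h2, h3, -⟩ := habs t ht
    unfold rateH
    rw [abs_mul, abs_of_nonneg h2]
    exact mul_le_mul h3 (hq t ht) (abs_nonneg _) (by positivity)
  · obtain ⟨h1, h2, h3, h4, h5, h6, h7, h8⟩ := habs t ht
    rw [abs_le] at h8
    have hBt := hB t ht
    have hO1 : om (S t) (M t) ≤ 1 := om_le.trans (by nlinarith [sq_nonneg (S t)])
    have hOκ := abs_le.1 (h.abs_om_mul_le ht (hκ t ht))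
    have i0 : |(2 - dec w (S t) (M t)) * (H t * S t)| ≤ 4 * B := by
      rw [abs_mul, abs_mul, abs_of_pos (by linarith : 0 < H t)]
      have j1 : |2 - dec w (S t) (M t)| ≤ 4 := abs_le.2 ⟨by linarith, by linarith⟩
      have j2 : H t * |S t| ≤ B := by nlinarith [h.abs_S_le ht, abs_nonneg (S t)]
      exact mul_le_mul j1 j2 (by positivity) (by norm_num)
    rw [abs_le] at i0
    have i1 : (H t ^ 2 - 1) * (1 - S t ^ 2) ≤ B ^ 2 := by nlinarith [sq_nonneg (S t)]
    have i2 : 0 ≤ (H t ^ 2 - 1) * (1 - S t ^ 2) := mul_nonneg h2 (h.one_sub_sq_pos ht).le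
    have i3 : M t ^ 2 / 3 ≤ 16 / 3 := by nlinarith
    have i4 : 0 ≤ M t ^ 2 / 3 := by positivity
    have i5 : K * om (S t) (M t) ≤ K := mul_le_of_le_one_right hK hO1
    unfold rateS
    rw [abs_le]
    constructor <;> nlinarith
  · obtain ⟨h1, h2, h3, h4, h5, h6, h7, h8⟩ := habs t ht
    have hBt := hB t ht
    unfold rateM
    rw [abs_mul, abs_of_pos h6]
    refine mul_le_mul h7.le ?_ (abs_nonneg _) (by norm_num)
    refine (abs_sub _ _).trans (add_le_add ((abs_sub _ _).trans (add_le_add ?_ ?_)) ?_)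
    · rw [abs_mul, abs_of_pos (by linarith : 0 < H t)]
      exact mul_le_mul h8 hBt (by linarith) (by norm_num)
    · rw [abs_mul]
      norm_num
      linarith [h.abs_S_le ht]
    · rw [abs_mul, abs_of_nonneg h2]
      nlinarith [h.abs_S_le ht, abs_nonneg (S t)]
  · rw [abs_of_pos (by linarith [h.one_lt t ht])]
    linarith [hB t ht]
  · linarith [h.abs_S_le ht]
  · rw [abs_of_pos (h.pos t ht)]
    linarith [h.M_lt_four ht]

end IsOrbit

/-! ### Perfect fluids and vacuum -/

namespace IsOrbit

variable {w : ℝ} {κ H S M : ℝ → ℝ}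

/-- A vacuum solution, or one with a perfect fluid with `w ≥ 0`, has `H → 2` and `Σ₊ → 1`. The
monotone function is `(H² - 1) / (H - S / 2)²`, which attains its maximum at this point. -/
theorem tendsto_of_nonneg (h : IsOrbit w κ H S M (Ici 0)) (hw : 0 ≤ w) (hw1 : w < 1)
    (hκ : ∀ t ∈ Ici (0 : ℝ), κ t = 0) :
    (∃ B, ∀ t ∈ Ici (0 : ℝ), H t ≤ B) ∧ Tendsto H atTop (𝓝 2) ∧ Tendsto S atTop (𝓝 1) := by
  have hw3 : -1 / 3 < w := by linarith
  have hκ' : ∀ t ∈ Ici (0 : ℝ), |κ t| ≤ 0 := fun t ht => by simp [hκ t ht]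
  have he : ∀ t ∈ Ici (0 : ℝ), H t / 2 ≤ H t - 1 / 2 * S t ∧ H t - 1 / 2 * S t ≤ H t + 1 / 2 :=
    fun t ht => by
      constructor <;> linarith [h.one_lt t ht, h.neg_one_lt t ht, h.lt_one t ht]
  have he0 : ∀ t ∈ Ici (0 : ℝ), 0 < H t - 1 / 2 * S t :=
    fun t ht => by linarith [h.one_lt t ht, (he t ht).1]
  have hL : ∀ t ∈ Ici (0 : ℝ), HasDerivWithinAt
      (fun t => Real.log (H t ^ 2 - 1) - 2 * Real.log (H t - 1 / 2 * S t))
      (((H t - 2 * S t) ^ 2 + 3 * w * om (S t) (M t) + M t ^ 2 / 4) / (H t - 1 / 2 * S t))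
      (Ici 0) t := fun t ht => by
    refine ((h.hasDerivWithinAt_log_sq_sub_one ht).sub
      ((h.hasDerivWithinAt_log_sub ht (he0 t ht)).const_mul 2)).congr_deriv ?_
    have := (he0 t ht).ne'
    rw [hκ t ht]
    unfold rateH rateS dec om
    rw [eq_div_iff this, sub_mul, mul_assoc 2 (_ / _), div_mul_cancel₀ _ this]
    ring
  have hL' : ∀ t ∈ Ici (0 : ℝ), (H t - 2 * S t) ^ 2 / (H t - 1 / 2 * S t) ≤
      ((H t - 2 * S t) ^ 2 + 3 * w * om (S t) (M t) + M t ^ 2 / 4) / (H t - 1 / 2 * S t) :=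
    fun t ht => by
      have := he0 t ht
      have hO := h.om_nonneg t ht
      gcongr
      nlinarith [sq_nonneg (M t), mul_nonneg hw hO]
  -- monotonicity gives `H² - 1 ≥ c H²`
  obtain ⟨c, hc, hkc⟩ : ∃ c > 0, ∀ t ∈ Ici (0 : ℝ), c * H t ^ 2 ≤ H t ^ 2 - 1 := by
    refine ⟨(H 0 ^ 2 - 1) / (H 0 - 1 / 2 * S 0) ^ 2 / 4, ?_, fun t ht => ?_⟩
    · have := h.sq_sub_one_pos (t := 0) self_mem_Ici
      have := he0 0 self_mem_Ici
      positivity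
    · have h1 := mul_sub_le_sub_of_le_derivWithin hL ht (Icc_subset_Ici_zero le_rfl) (c := 0)
        fun u hu => (div_nonneg (sq_nonneg _) (he0 u hu.1).le).trans (hL' u hu.1)
      have k0 := h.sq_sub_one_pos (t := 0) self_mem_Ici
      have e0 := he0 0 self_mem_Ici
      have kt := h.sq_sub_one_pos ht
      have et := he0 t ht
      have hlog : ∀ {a b : ℝ}, 0 < a → 0 < b →
          Real.log a - 2 * Real.log b = Real.log (a / b ^ 2) := fun ha hb => by
        rw [Real.log_div ha.ne' (pow_pos hb 2).ne', Real.log_pow]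
        norm_num
      rw [hlog kt et, hlog k0 e0, zero_mul, sub_nonneg,
        Real.log_le_log_iff (by positivity) (by positivity), le_div_iff₀ (by positivity)] at h1
      refine le_trans ?_ h1
      have : H t ^ 2 ≤ 4 * (H t - 1 / 2 * S t) ^ 2 := by nlinarith [h.one_lt t ht, (he t ht).1]
      rw [div_mul_eq_mul_div, div_le_iff₀ four_pos, mul_assoc]
      refine mul_le_mul_of_nonneg_left ?_ (by positivity)
      linarith
  have hc1 : c < 1 := by
    have := hkc 0 self_mem_Ici
    nlinarith [h.one_lt 0 self_mem_Ici]
  have hS : ∀ᶠ t in atTop, c / 4 ≤ S t := by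
    refine h.eventually_le_S (c := c / 2) (by positivity) (by linarith) (by linarith) ?_
    filter_upwards [eventually_ge_atTop (0 : ℝ)] with t ht hSt
    have i1 := h.one_lt t ht
    have i2 := hkc t ht
    have i3 := h.one_sub_sq_pos ht
    rcases le_total 0 (S t) with h0 | h0
    · refine le_trans ?_ (h.le_rateS_of_nonneg ht hw3 h0)
      rw [hκ t ht]
      have j1 : H t * S t ≤ H t * (c / 4) := mul_le_mul_of_nonneg_left hSt (by linarith)
      have j2 : c * H t ≤ c * H t ^ 2 := mul_le_mul_of_nonneg_left (by nlinarith) hc.le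
      have j3 : c * 1 ≤ c * H t := mul_le_mul_of_nonneg_left i1.le hc.le
      have : c / 2 ≤ H t ^ 2 - 1 - 2 * H t * S t := by linarith
      nlinarith [sq_nonneg (M t), mul_le_mul_of_nonneg_left this i3.le]
    · refine le_trans ?_ (h.le_rateS_of_nonpos ht hw1 h0)
      rw [hκ t ht]
      have : c / 2 ≤ H t ^ 2 - 1 := by nlinarith
      nlinarith [sq_nonneg (M t), mul_le_mul_of_nonneg_left this i3.le]
  obtain ⟨B, hB⟩ := h.exists_H_le hw1 (by positivity) hS
  have hB1 : 1 < B := (h.one_lt 0 self_mem_Ici).trans_le (hB 0 self_mem_Ici)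
  have hφ : Tendsto (fun t => 1 / (B + 1) * (H t - 2 * S t) ^ 2) atTop (𝓝 0) := by
    refine tendsto_zero_of_le_deriv hL (B := 4 * B) (h.uniformContinuousOn_comp hw3 hw1 hκ' hB
      (g := fun x => 1 / (B + 1) * (x.1 - 2 * x.2.1) ^ 2) (by fun_prop))
      (fun t _ => by positivity) (fun t ht => le_trans ?_ (hL' t ht)) fun t ht => ?_
    · have := he0 t ht
      have h2 : H t - 1 / 2 * S t ≤ B + 1 := by linarith [(he t ht).2, hB t ht]
      rw [div_mul_eq_mul_div, one_mul]
      gcongr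
    · have i1 := h.one_lt t ht
      have i2 := Real.log_le_log (by linarith) (he t ht).1
      have i3 := h.log_sq_sub_one_le ht
      rw [Real.log_div (by linarith) two_ne_zero] at i2
      have i4 := Real.log_two_lt_d9
      linarith
  have hd : Tendsto (fun t => H t - 2 * S t) atTop (𝓝 0) :=
    tendsto_zero_of_const_mul_sq (by positivity) hφ
  have hm := h.tendsto_M_sq hw3 hw1 hκ' hB
  have hH : Tendsto H atTop (𝓝 2) := by
    rw [tendsto_order]
    constructor
    · intro b hb
      set ε := min ((2 - b) / 2) 1 with hε
      have hε0 : 0 < ε := lt_min (by linarith) one_pos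
      have hε1 : ε ≤ 1 := min_le_right _ _
      have hεb : b < 2 - ε := by linarith [min_le_left ((2 - b) / 2) 1]
      have : ∀ᶠ t in atTop, 2 - ε ≤ H t := by
        refine eventually_ge_of_le_deriv h.deriv_H (c := c * (ε / 32)) (by positivity) ?_
        filter_upwards [eventually_ge_atTop (0 : ℝ), (tendsto_order.1 hm).2 (ε / 2) (by positivity),
          (tendsto_order.1 hd).1 (-(ε / 32)) (by linarith),
          (tendsto_order.1 hd).2 (ε / 32) (by linarith), hS] with t ht i1 i2 i3 i0 hle
        have i4 := h.one_lt t ht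
        have i5 := h.lt_one t ht
        have i6 : c ≤ H t ^ 2 - 1 := by nlinarith [hkc t ht]
        have i7 : S t ≤ 1 - ε / 4 := by linarith
        have i8 : ε / 8 ≤ om (S t) (M t) := by
          unfold om
          nlinarith
        have i9 : ε / 32 ≤ dec w (S t) (M t) - H t * S t := by
          have j1 : dec w (S t) (M t) - H t * S t =
              (1 + 3 * w) / 2 * om (S t) (M t) - S t * (H t - 2 * S t) := by
            unfold dec
            ring
          have j2 : S t * (H t - 2 * S t) ≤ ε / 32 := by nlinarith
          rw [j1]
          nlinarith
        unfold rateH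
        exact mul_le_mul i6 i9 (by positivity) (hc.le.trans i6)
      filter_upwards [this] with t ht
      linarith
    · intro b hb
      filter_upwards [eventually_ge_atTop (0 : ℝ), (tendsto_order.1 hd).2 (b - 2) (by linarith)]
        with t ht i1
      linarith [h.lt_one t ht]
  refine ⟨⟨B, hB⟩, hH, ?_⟩
  have h1 := (hH.sub hd).div_const 2
  norm_num at h1
  exact h1

/-- If `H² - 1` stays away from `0` and `q - H Σ₊` approaches a positive multiple of `X² - H²`, then
`H` tends to `X`. -/
theorem tendsto_H (h : IsOrbit w κ H S M (Ici 0)) {k₀ A X : ℝ} (hk₀ : 0 < k₀)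
    (hk : ∀ t ∈ Ici (0 : ℝ), k₀ ≤ H t ^ 2 - 1) (hA : 0 < A) (hX : 0 < X)
    (hauto : Tendsto (fun t => dec w (S t) (M t) - H t * S t - A * (X ^ 2 - H t ^ 2)) atTop (𝓝 0)) :
    Tendsto H atTop (𝓝 X) := by
  have hc : ∀ ε : ℝ, 0 < ε → 0 < A * (ε * X) := fun ε hε => by positivity
  rw [tendsto_order]
  constructor
  · intro b hb
    set ε := (X - b) / 2 with hε
    have hε0 : 0 < ε := by linarith
    have hcε := hc ε hε0
    have : ∀ᶠ t in atTop, X - ε ≤ H t := by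
      refine eventually_ge_of_le_deriv h.deriv_H (c := k₀ * (A * (ε * X) / 2)) (by positivity) ?_
      filter_upwards [eventually_ge_atTop (0 : ℝ),
        (tendsto_order.1 hauto).1 (-(A * (ε * X) / 2)) (by linarith)] with t ht i1 hle
      have i4 := h.one_lt t ht
      have i5 : ε * X ≤ X ^ 2 - H t ^ 2 := by nlinarith
      have i6 := mul_le_mul_of_nonneg_left i5 hA.le
      unfold rateH
      exact mul_le_mul (hk t ht) (by linarith) (by positivity) (h.sq_sub_one_pos ht).le
    filter_upwards [this] with t ht
    linarith
  · intro b hb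
    set ε := (b - X) / 2 with hε
    have hε0 : 0 < ε := by linarith
    have hcε := hc ε hε0
    have : ∀ᶠ t in atTop, H t ≤ X + ε := by
      refine eventually_le_of_deriv_le h.deriv_H (c := k₀ * (A * (ε * X) / 2)) (by positivity) ?_
      filter_upwards [eventually_ge_atTop (0 : ℝ),
        (tendsto_order.1 hauto).2 (A * (ε * X) / 2) (by linarith)] with t ht i1 hle
      have i5 : ε * X ≤ H t ^ 2 - X ^ 2 := by nlinarith
      have i6 := mul_le_mul_of_nonneg_left i5 hA.le
      have i9 : A * (ε * X) / 2 ≤ -(dec w (S t) (M t) - H t * S t) := by linarith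
      have := mul_le_mul (hk t ht) i9 (by positivity) (h.sq_sub_one_pos ht).le
      unfold rateH
      linarith
    filter_upwards [this] with t ht
    linarith

/-- A perfect fluid solution with `-1/3 < w < 0` has `H → 1 / (1 - ν)` and `Σ₊ → ν / (1 - ν)`, where
`ν = (1 + 3 w) / 2`. The monotone function is a product of powers of `H² - 1`, `Ω` and `H - ν S`. It
is bounded, whence `H` is bounded, `H² - 1` is bounded below, and `Σ₊ - ν H → 0`. -/
theorem tendsto_of_neg (h : IsOrbit w κ H S M (Ici 0)) (hw : -1 / 3 < w) (hw0 : w < 0)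
    (hκ : ∀ t ∈ Ici (0 : ℝ), κ t = 0) (hO : ∀ t ∈ Ici (0 : ℝ), 0 < om (S t) (M t)) :
    (∃ B, ∀ t ∈ Ici (0 : ℝ), H t ≤ B) ∧ Tendsto H atTop (𝓝 (1 / (1 - (1 + 3 * w) / 2))) ∧
      Tendsto S atTop (𝓝 ((1 + 3 * w) / 2 * (1 / (1 - (1 + 3 * w) / 2)))) := by
  have hw1 : w < 1 := by linarith
  have hκ' : ∀ t ∈ Ici (0 : ℝ), |κ t| ≤ 0 := fun t ht => by simp [hκ t ht]
  obtain ⟨ν, hν⟩ : ∃ ν, ν = (1 + 3 * w) / 2 := ⟨_, rfl⟩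
  have hν0 : 0 < ν := by linarith
  have hν1 : ν < 1 / 2 := by linarith
  have hwν : w = (2 * ν - 1) / 3 := by linarith
  rw [← hν]
  have he : ∀ t ∈ Ici (0 : ℝ), (1 - ν) * H t ≤ H t - ν * S t ∧ H t - ν * S t ≤ H t + 1 :=
    fun t ht => by
      constructor <;> nlinarith [h.one_lt t ht, h.neg_one_lt t ht, h.lt_one t ht]
  have he0 : ∀ t ∈ Ici (0 : ℝ), 0 < H t - ν * S t :=
    fun t ht => by nlinarith [h.one_lt t ht, (he t ht).1]
  -- with these exponents, the terms of the rate without `M` combine to a square, which vanishes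
  -- where `S = ν H`
  set α := ν * (2 - ν) with hα
  set γ := 1 - 2 * ν with hγ
  have hα0 : 0 < α := mul_pos hν0 (by linarith)
  have hγ0 : 0 < γ := by linarith
  have hL : ∀ t ∈ Ici (0 : ℝ), HasDerivWithinAt
      (fun t => α * Real.log (H t ^ 2 - 1) + γ * Real.log (om (S t) (M t))
        - 2 * (α + γ) * Real.log (H t - ν * S t))
      ((2 * (2 - ν) * (ν * H t - S t) ^ 2 + (α + γ) * (ν / 2) * M t ^ 2) / (H t - ν * S t))
      (Ici 0) t := fun t ht => by
    refine ((((h.hasDerivWithinAt_log_sq_sub_one ht).const_mul α).add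
      ((h.hasDerivWithinAt_log_om ht (hO t ht)).const_mul γ)).sub
      ((h.hasDerivWithinAt_log_sub ht (he0 t ht)).const_mul (2 * (α + γ)))).congr_deriv ?_
    have := (he0 t ht).ne'
    rw [hκ t ht]
    unfold rateH rateS dec om
    rw [eq_div_iff this, sub_mul, mul_assoc (2 * (α + γ)) (_ / _), div_mul_cancel₀ _ this, hα, hγ,
      hwν]
    ring
  have hL' : ∀ t ∈ Ici (0 : ℝ), 2 * (2 - ν) * (ν * H t - S t) ^ 2 / (H t - ν * S t) ≤
      (2 * (2 - ν) * (ν * H t - S t) ^ 2 + (α + γ) * (ν / 2) * M t ^ 2) / (H t - ν * S t) :=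
    fun t ht => by
      have := he0 t ht
      gcongr
      have : 0 ≤ (α + γ) * (ν / 2) * M t ^ 2 := by positivity
      linarith
  have hL0 : ∀ t ∈ Ici (0 : ℝ), 0 ≤
      2 * (2 - ν) * (ν * H t - S t) ^ 2 / (H t - ν * S t) := fun t ht =>
    div_nonneg (mul_nonneg (by linarith) (sq_nonneg _)) (he0 t ht).le
  have hmono : ∀ t ∈ Ici (0 : ℝ), _ ≤ _ := fun t ht =>
    mul_sub_le_sub_of_le_derivWithin hL ht (Icc_subset_Ici_zero le_rfl) (c := 0)
      fun u hu => (hL0 u hu.1).trans (hL' u hu.1)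
  set L₀ := α * Real.log (H 0 ^ 2 - 1) + γ * Real.log (om (S 0) (M 0))
        - 2 * (α + γ) * Real.log (H 0 - ν * S 0) with hL₀
  have hlogs : ∀ t ∈ Ici (0 : ℝ), Real.log (H t ^ 2 - 1) ≤ 2 * Real.log (H t) ∧
      Real.log (om (S t) (M t)) ≤ 0 ∧
      Real.log (1 - ν) + Real.log (H t) ≤ Real.log (H t - ν * S t) ∧ 0 ≤ Real.log (H t) :=
    fun t ht => by
      have i1 := h.one_lt t ht
      refine ⟨h.log_sq_sub_one_le ht, Real.log_nonpos (hO t ht).le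
        (om_le.trans (by nlinarith [sq_nonneg (S t)])), ?_, Real.log_nonneg i1.le⟩
      rw [← Real.log_mul (by linarith) (by linarith)]
      exact Real.log_le_log (mul_pos (by linarith) (by linarith)) (he t ht).1
  obtain ⟨B, hB⟩ : ∃ B, ∀ t ∈ Ici (0 : ℝ), H t ≤ B := by
    refine ⟨Real.exp ((-2 * (α + γ) * Real.log (1 - ν) - L₀) / (2 * γ)), fun t ht => ?_⟩
    rw [← Real.log_le_iff_le_exp (by linarith [h.one_lt t ht]), le_div_iff₀ (by positivity)]
    obtain ⟨i1, i2, i3, i4⟩ := hlogs t ht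
    have i5 := hmono t ht
    have j1 := mul_le_mul_of_nonneg_left i1 hα0.le
    have j2 := mul_le_mul_of_nonneg_left i2 hγ0.le
    have j3 := mul_le_mul_of_nonneg_left i3 (by positivity : 0 ≤ 2 * (α + γ))
    simp only [hL₀]
    linarith
  obtain ⟨k₀, hk₀, hk⟩ : ∃ k₀ > 0, ∀ t ∈ Ici (0 : ℝ), k₀ ≤ H t ^ 2 - 1 := by
    refine ⟨Real.exp ((L₀ + 2 * (α + γ) * Real.log (1 - ν)) / α), Real.exp_pos _, fun t ht => ?_⟩
    rw [← Real.le_log_iff_exp_le (h.sq_sub_one_pos ht), div_le_iff₀ hα0]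
    obtain ⟨i1, i2, i3, i4⟩ := hlogs t ht
    have i5 := hmono t ht
    have j2 := mul_le_mul_of_nonneg_left i2 hγ0.le
    have j3 := mul_le_mul_of_nonneg_left i3 (by positivity : 0 ≤ 2 * (α + γ))
    have j4 := mul_nonneg (by positivity : 0 ≤ 2 * (α + γ)) i4
    simp only [hL₀]
    linarith
  have hB1 : 1 < B := (h.one_lt 0 self_mem_Ici).trans_le (hB 0 self_mem_Ici)
  have hφ : Tendsto (fun t => 2 * (2 - ν) / (B + 1) * (ν * H t - S t) ^ 2) atTop (𝓝 0) := by
    have h2ν : 0 ≤ 2 * (2 - ν) := by linarith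
    refine tendsto_zero_of_le_deriv hL (B := -2 * (α + γ) * Real.log (1 - ν))
      (h.uniformContinuousOn_comp hw hw1 hκ' hB
      (g := fun x => 2 * (2 - ν) / (B + 1) * (ν * x.1 - x.2.1) ^ 2) (by fun_prop))
      (fun t _ => by positivity) (fun t ht => le_trans ?_ (hL' t ht)) fun t ht => ?_
    · have := he0 t ht
      have h2 : H t - ν * S t ≤ B + 1 := by linarith [(he t ht).2, hB t ht]
      rw [div_mul_eq_mul_div]
      gcongr
    · obtain ⟨i1, i2, i3, i4⟩ := hlogs t ht
      have j1 := mul_le_mul_of_nonneg_left i1 hα0.le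
      have j2 := mul_le_mul_of_nonneg_left i2 hγ0.le
      have j3 := mul_le_mul_of_nonneg_left i3 (by positivity : 0 ≤ 2 * (α + γ))
      have j4 := mul_nonneg hγ0.le i4
      linarith
  have hd : Tendsto (fun t => ν * H t - S t) atTop (𝓝 0) :=
    tendsto_zero_of_const_mul_sq (div_pos (by linarith) (by linarith)).ne' hφ
  have hm := h.tendsto_M_sq hw hw1 hκ' hB
  have hp : 0 < 1 - ν := by linarith
  have hX2 : (1 - ν) ^ 2 * (1 / (1 - ν)) ^ 2 = 1 := by
    rw [← mul_pow, mul_one_div_cancel hp.ne', one_pow]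
  -- the equation for `H` decouples asymptotically
  have hauto : Tendsto (fun t => dec w (S t) (M t) - H t * S t
      - ν * (1 - ν) ^ 2 * ((1 / (1 - ν)) ^ 2 - H t ^ 2)) atTop (𝓝 0) := by
    have h1 : ∀ᶠ t in atTop, |dec w (S t) (M t) - H t * S t
        - ν * (1 - ν) ^ 2 * ((1 / (1 - ν)) ^ 2 - H t ^ 2)| ≤
        (2 * (1 + B) + B) * |ν * H t - S t| + M t ^ 2 := by
      filter_upwards [eventually_ge_atTop (0 : ℝ)] with t ht
      have e : dec w (S t) (M t) - H t * S t
          - ν * (1 - ν) ^ 2 * ((1 / (1 - ν)) ^ 2 - H t ^ 2) =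
          (-(2 - ν) * (S t + ν * H t) + H t) * (ν * H t - S t) - ν / 12 * M t ^ 2 := by
        unfold dec om
        rw [hwν]
        linear_combination -ν * hX2
      rw [e]
      refine (abs_sub _ _).trans (add_le_add ?_ ?_)
      · rw [abs_mul]
        refine mul_le_mul_of_nonneg_right ?_ (abs_nonneg _)
        have i1 := h.one_lt t ht
        have i2 := hB t ht
        have i3 := abs_le.1 (h.abs_S_le ht)
        have i4 : S t + ν * H t ≤ 1 + B := by nlinarith
        have i5 : -1 ≤ S t + ν * H t := by nlinarith
        rw [abs_le]
        constructor <;> nlinarith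
      · rw [abs_of_nonneg (by positivity)]
        nlinarith [sq_nonneg (M t)]
    refine squeeze_zero_norm' h1 ?_
    simpa using (hd.abs.const_mul (2 * (1 + B) + B)).add hm
  have hH := h.tendsto_H hk₀ hk (by positivity) (by positivity) hauto
  refine ⟨⟨B, hB⟩, hH, ?_⟩
  have h1 := (hH.const_mul ν).sub hd
  simpa using h1

end IsOrbit

/-! ### Anisotropic matter -/

/-- The derivative of the function `-log (H² - 1) + γ log Ω - 2 (γ - 1) log (H - v S)`: up to the
terms with `η = κ + p / 3`, it is nonnegative. -/
theorem anisotropic_rate_eq {H S M a p v γ η : ℝ} (ha : a = 2 - v - v * p)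
    (hγ : γ * (v * a + p) = 2 * v - 1) (he : H - v * S ≠ 0) :
    -(2 * H * (dec ((3 - 2 * a) / 3) S M - H * S))
      + γ * ((2 * dec ((3 - 2 * a) / 3) S M - (1 + 3 * ((3 - 2 * a) / 3))) * H
        - 2 * (H ^ 2 - 1) * S - 6 * S * (-p / 3 + η))
      - 2 * (γ - 1) * ((rateH ((3 - 2 * a) / 3) H S M
        - v * rateS ((3 - 2 * a) / 3) (-p / 3 + η) H S M) / (H - v * S))
    = 2 * ((γ * a - 2) * (S - v * H) ^ 2 + (γ - 1) * (v * M ^ 2 / 4)) / (H - v * S)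
      + (6 * (γ - 1) * v * om S M / (H - v * S) - 6 * γ * S) * η := by
  have key : ∀ A X R N P Q e : ℝ, e ≠ 0 → A * e - X * R = N + (P - Q * e) * η →
      A - X * (R / e) = N / e + (P / e - Q) * η := fun A X R N P Q e he h => by
    field_simp
    linarith
  refine key _ _ _ _ _ _ _ he ?_
  unfold rateH rateS dec om
  subst ha
  linear_combination (2 * H * (S - v * H)) * hγ

/-- The slope `v` and the exponent `γ` of the monotone function for anisotropic matter: the two
equations make its rate a square up to a multiple of `M²`, and `γ a > 2` gives the square the right
sign. -/
theorem exists_exponents {a β : ℝ} (ha2 : a < 2) (hβ : β < 0) (hβ2 : -1 / 2 < β)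
    (hreg : 2 - a + β + a * β ^ 2 < 0) (ha0 : 0 < a) :
    ∃ v γ : ℝ, 0 < v ∧ v < -β ∧ a = 2 - v - v * (a * β) ∧ v * a + a * β < 0 ∧
      γ * (v * a + a * β) = 2 * v - 1 ∧ 0 < γ * a - 2 := by
  have hp1 : 0 < 1 + a * β := by
    have : β * (1 + a * β) < 0 := by nlinarith
    by_contra hcon
    nlinarith
  obtain ⟨v, hv⟩ : ∃ v, v = (2 - a) / (1 + a * β) := ⟨_, rfl⟩
  have hvp : v * (1 + a * β) = 2 - a := by
    rw [hv]
    exact div_mul_cancel₀ _ hp1.ne'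
  have hv0 : 0 < v := by
    rw [hv]
    exact div_pos (by linarith) hp1
  have hvβ : v < -β := by
    rw [hv, div_lt_iff₀ hp1]
    linarith
  have hU : v * a + a * β < 0 := by nlinarith
  obtain ⟨γ, hγdef⟩ : ∃ γ, γ = (2 * v - 1) / (v * a + a * β) := ⟨_, rfl⟩
  have hγ : γ * (v * a + a * β) = 2 * v - 1 := by
    rw [hγdef]
    exact div_mul_cancel₀ _ hU.ne
  refine ⟨v, γ, hv0, hvβ, by linarith, hU, hγ, ?_⟩
  have : (γ * a - 2) * (v * a + a * β) = -(a * (1 + 2 * β)) := by linear_combination a * hγ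
  by_contra hcon
  have h1 : 0 ≤ (γ * a - 2) * (v * a + a * β) := mul_nonneg_of_nonpos_of_nonpos (by linarith) hU.le
  have h2 : 0 < a * (1 + 2 * β) := mul_pos ha0 (by linarith)
  linarith

/-- A lower bound of the expression in `anisotropic_rate_eq`. -/
theorem anisotropic_rate_ge {H S M a v γ η B E : ℝ} (hv0 : 0 < v) (hv1 : v < 1 / 2) (hγ1 : 1 < γ)
    (hg2 : 0 < γ * a - 2) (hO : 0 < om S M) (hS : |S| ≤ 1) (e1 : 1 / 2 ≤ H - v * S)
    (e2 : H - v * S ≤ B + 1) (hη : |η| ≤ E) :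
    2 * (γ * a - 2) / (B + 1) * (S - v * H) ^ 2 ≤
      2 * ((γ * a - 2) * (S - v * H) ^ 2 + (γ - 1) * (v * M ^ 2 / 4)) / (H - v * S)
        + (6 * (γ - 1) * v * om S M / (H - v * S) - 6 * γ * S) * η + 18 * γ * E := by
  have ep : 0 < H - v * S := by linarith
  have i1 : 2 * (γ * a - 2) / (B + 1) * (S - v * H) ^ 2 ≤
      2 * ((γ * a - 2) * (S - v * H) ^ 2 + (γ - 1) * (v * M ^ 2 / 4)) / (H - v * S) := by
    have j1 : 2 * (γ * a - 2) / (B + 1) * (S - v * H) ^ 2 ≤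
        2 * (γ * a - 2) * (S - v * H) ^ 2 / (H - v * S) := by
      rw [div_mul_eq_mul_div]
      gcongr
    refine j1.trans (div_le_div_of_nonneg_right ?_ ep.le)
    have : 0 ≤ (γ - 1) * (v * M ^ 2 / 4) := mul_nonneg (by linarith) (by positivity)
    linarith
  have i2 : |6 * (γ - 1) * v * om S M / (H - v * S) - 6 * γ * S| ≤ 18 * γ := by
    have hO1 : om S M ≤ 1 := om_le.trans (by nlinarith [sq_nonneg S])
    have j0 : 0 ≤ γ - 1 := by linarith
    have j1 : 6 * (γ - 1) * v * om S M / (H - v * S) ≤ 12 * γ := by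
      rw [div_le_iff₀ ep]
      have k1 : v * om S M ≤ 1 := mul_le_one₀ (by linarith) hO.le hO1
      have k2 := mul_le_mul_of_nonneg_left k1 (by linarith : 0 ≤ 6 * (γ - 1))
      have k3 := mul_le_mul_of_nonneg_left e1 (by linarith : 0 ≤ 12 * γ)
      linarith
    have j2 : 0 ≤ 6 * (γ - 1) * v * om S M / (H - v * S) := by positivity
    have i3 := abs_le.1 hS
    have k4 := mul_le_mul_of_nonneg_left i3.1 (by linarith : 0 ≤ 6 * γ)
    have k5 := mul_le_mul_of_nonneg_left i3.2 (by linarith : 0 ≤ 6 * γ)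
    rw [abs_le]
    constructor <;> linarith
  have i3 := mul_le_mul i2 hη (abs_nonneg _) (by linarith)
  rw [← abs_mul] at i3
  have i4 := (abs_le.1 i3).1
  linarith

namespace IsOrbit

variable {w K : ℝ} {κ H S M : ℝ → ℝ}

section

variable {a β : ℝ} (h : IsOrbit w κ H S M (Ici 0)) (hwa : w = (3 - 2 * a) / 3)
  (ha1 : 1 < a) (ha2 : a < 2) (hβ : β < 0) (hβ2 : -1 / 2 < β)
  (hη : Tendsto (fun t => κ t + a * β / 3) atTop (𝓝 0))
include h hwa ha1 ha2 hβ hβ2 hη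

/-- Anisotropic matter with `β < 0` drives `Σ₊` to positive values. -/
theorem eventually_neg_half_le_S : ∀ᶠ t in atTop, -β / 2 ≤ S t := by
  have hw : -1 / 3 < w := by linarith
  have hw1 : w < 1 := by linarith
  have hc : 0 < (a - 1) * -β := mul_pos (by linarith) (by linarith)
  refine h.eventually_le_S (c := (a - 1) * -β / 2) (by linarith) (by linarith) (by linarith) ?_
  filter_upwards [eventually_ge_atTop (0 : ℝ),
    (tendsto_order.1 hη).1 (-((a - 1) * -β / 6)) (by linarith)] with t ht i1 hS
  have i2 := h.one_lt t ht
  have i3 := h.one_sub_sq_pos ht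
  have hO := h.om_nonneg t ht
  have hOle := om_le (S := S t) (M := M t)
  -- the contribution of the shear sources
  have i4 : (1 - S t ^ 2) * (-(a * β) - (a - 1) * -β / 2) ≤
      M t ^ 2 / 3 + 3 * om (S t) (M t) * κ t := by
    have j1 : M t ^ 2 / 3 = 4 * (1 - S t ^ 2 - om (S t) (M t)) := by
      unfold om
      ring
    have j2 : om (S t) (M t) * (-(a * β) - (a - 1) * -β / 2) ≤ om (S t) (M t) * (3 * κ t) :=
      mul_le_mul_of_nonneg_left (by linarith) hO
    have j3 : -(a * β) - (a - 1) * -β / 2 ≤ 4 := by nlinarith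
    have j4 := mul_le_mul_of_nonneg_left j3 (sub_nonneg.2 hOle)
    rw [j1]
    linarith
  rcases le_total 0 (S t) with h0 | h0
  · refine le_trans ?_ (h.le_rateS_of_nonneg ht hw h0)
    have j1 : (a - 1) * -β ≤ H t ^ 2 - 1 - 2 * H t * S t - a * β := by nlinarith
    have := mul_le_mul_of_nonneg_left j1 i3.le
    linarith
  · refine le_trans ?_ (h.le_rateS_of_nonpos ht hw1 h0)
    have j1 : (a - 1) * -β ≤ H t ^ 2 - 1 - a * β := by nlinarith
    have := mul_le_mul_of_nonneg_left j1 i3.le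
    linarith

/-- If `H → 1`, then the equation for `Σ₊` is asymptotic to `Σ₊' = -a (1 - Σ₊²) (Σ₊ + β)`. -/
theorem tendsto_rateS_add {B : ℝ} (hB : ∀ t ∈ Ici (0 : ℝ), H t ≤ B)
    (hκ : ∀ t ∈ Ici (0 : ℝ), |κ t| ≤ K) (hH : Tendsto H atTop (𝓝 1)) :
    Tendsto (fun t => rateS w (κ t) (H t) (S t) (M t) + a * (1 - S t ^ 2) * (S t + β))
      atTop (𝓝 0) := by
  have hw : -1 / 3 < w := by linarith
  have hw1 : w < 1 := by linarith
  have hm := h.tendsto_M_sq hw hw1 hκ hB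
  have hlim : Tendsto (fun t => 2 * (H t - 1) + (B + 2) * M t ^ 2 + 3 * |κ t + a * β / 3|
      + (H t ^ 2 - 1)) atTop (𝓝 0) := by
    have := (((hH.sub_const 1).const_mul 2).add (hm.const_mul (B + 2))).add
      (hη.abs.const_mul 3) |>.add ((hH.pow 2).sub_const 1)
    simpa using this
  refine squeeze_zero_norm' ?_ hlim
  filter_upwards [eventually_ge_atTop (0 : ℝ)] with t ht
  have i1 := h.one_lt t ht
  have i2 := hB t ht
  have i3 := abs_le.1 (h.abs_S_le ht)
  have hO := h.om_nonneg t ht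
  have hk0 := h.sq_sub_one_pos ht
  have hS2 := h.one_sub_sq_pos ht
  have hO1 : om (S t) (M t) ≤ 1 := om_le.trans (by nlinarith [sq_nonneg (S t)])
  have e : rateS w (κ t) (H t) (S t) (M t) + a * (1 - S t ^ 2) * (S t + β)
      = -(a * (1 - S t ^ 2) * S t) * (H t - 1)
        + (a * (H t * S t + β) / 12 + 1 / 3 - H t * S t / 6) * M t ^ 2
        + 3 * om (S t) (M t) * (κ t + a * β / 3) + (1 - S t ^ 2) * (H t ^ 2 - 1) := by
    unfold rateS dec om
    rw [hwa]
    ring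
  rw [Real.norm_eq_abs, e]
  have hHS : |H t * S t| ≤ B := by
    rw [abs_mul, abs_of_pos (by linarith)]
    nlinarith [h.abs_S_le ht, abs_nonneg (S t)]
  have hHS' := abs_le.1 hHS
  refine (abs_add_le _ _).trans (add_le_add ((abs_add_le _ _).trans (add_le_add
    ((abs_add_le _ _).trans (add_le_add ?_ ?_)) ?_)) ?_)
  · rw [abs_mul, abs_of_pos (by linarith : 0 < H t - 1), abs_neg, abs_mul,
      abs_of_nonneg (by positivity)]
    refine mul_le_mul_of_nonneg_right ?_ (by linarith)
    have : a * (1 - S t ^ 2) ≤ 2 := by nlinarith [sq_nonneg (S t)]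
    nlinarith [h.abs_S_le ht, abs_nonneg (S t), mul_pos (by linarith : 0 < a) hS2]
  · rw [abs_mul, abs_of_nonneg (sq_nonneg (M t))]
    refine mul_le_mul_of_nonneg_right ?_ (sq_nonneg _)
    rw [abs_le]
    have j1 : a * (H t * S t) ≤ 2 * B := by nlinarith
    have j2 : -(2 * B) ≤ a * (H t * S t) := by nlinarith
    have j3 : -2 ≤ a * β := by nlinarith
    have j4 : a * β ≤ 0 := by nlinarith
    constructor <;> linarith
  · rw [abs_mul, abs_of_nonneg (by positivity)]
    refine mul_le_mul_of_nonneg_right ?_ (abs_nonneg _)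
    linarith
  · rw [abs_mul, abs_of_pos hS2, abs_of_pos hk0]
    nlinarith [sq_nonneg (S t)]

theorem tendsto_S_of_tendsto_H {B : ℝ} (hB : ∀ t ∈ Ici (0 : ℝ), H t ≤ B)
    (hκ : ∀ t ∈ Ici (0 : ℝ), |κ t| ≤ K)
    (hk : ∀ b, ∀ᶠ t in atTop, Real.log (H t ^ 2 - 1) ≤ b) (hH : Tendsto H atTop (𝓝 1)) :
    Tendsto S atTop (𝓝 (-β)) := by
  have hw : -1 / 3 < w := by linarith
  have hS0 := h.eventually_neg_half_le_S hwa ha1 ha2 hβ hβ2 hη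
  have hauto := h.tendsto_rateS_add hwa ha1 ha2 hβ hβ2 hη hB hκ hH
  rw [tendsto_order]
  constructor
  · intro b hb
    set b' := (max b (-β / 2) + -β) / 2 with hb'
    have hmax : max b (-β / 2) < -β := max_lt hb (by linarith)
    have hb1 : b < b' := by linarith [le_max_left b (-β / 2)]
    have hb2 : b' < -β := by linarith
    have : ∀ᶠ t in atTop, b' ≤ S t := by
      refine eventually_ge_of_le_deriv h.deriv_S (c := (-β - b') / 4) (by linarith) ?_
      filter_upwards [hS0, (tendsto_order.1 hauto).1 (-((-β - b') / 2)) (by linarith)]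
        with t i1 i2 hle
      have j0 : S t ^ 2 ≤ 1 / 4 := by nlinarith
      have j1 : 3 / 4 ≤ a * (1 - S t ^ 2) := by nlinarith
      have j2 := mul_le_mul j1 (by linarith : -β - b' ≤ -(S t + β)) (by linarith) (by linarith)
      linarith
    filter_upwards [this] with t ht
    linarith
  · intro b hb
    set b' := (min b (9 / 10) + -β) / 2 with hb'
    have hmin : -β < min b (9 / 10) := lt_min hb (by linarith)
    have hb1 : b' < b := by linarith [min_le_left b (9 / 10)]
    have hb2 : -β < b' := by linarith
    have hb3 : b' ≤ 9 / 10 := by linarith [min_le_right b (9 / 10)]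
    -- `Σ₊` cannot stay near `1`, because `H² - 1` grows there
    have hfreq : ∃ᶠ t in atTop, S t ≤ 9 / 10 := by
      intro hcon
      obtain ⟨T, ⟨hT0, hT⟩⟩ := ((eventually_ge_atTop (0 : ℝ)).and (eventually_forall_ge_atTop.2
        (hcon.and ((tendsto_order.1 hH).2 (11 / 10) (by norm_num))))).exists
      obtain ⟨t, htT, ht⟩ := ((eventually_ge_atTop T).and
        (hk (Real.log (H T ^ 2 - 1) - 1))).exists
      have h1 := mul_sub_le_sub_of_le_derivWithin
        (fun t ht => h.hasDerivWithinAt_log_sq_sub_one ht) htT (Icc_subset_Ici_zero hT0) (c := 0)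
        fun u hu => by
          have hu0 : 0 ≤ u := hT0.trans hu.1
          obtain ⟨j1, j2⟩ := hT u hu.1
          rw [not_le] at j1
          have j3 := h.one_lt u hu0
          have j4 := h.lt_one u hu0
          have j5 : 2 * S u ^ 2 ≤ dec w (S u) (M u) := by
            unfold dec
            nlinarith [mul_nonneg (by linarith : 0 ≤ (1 + 3 * w) / 2) (h.om_nonneg u hu0)]
          have j6 : 0 ≤ dec w (S u) (M u) - H u * S u := by nlinarith
          exact mul_nonneg (by linarith) j6
      linarith
    have : ∀ᶠ t in atTop, S t ≤ b' := by
      refine eventually_le_of_deriv_le_of_frequently_le h.deriv_S (c := (b' + β) / 20)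
        (by linarith) hb3 hfreq ?_
      filter_upwards [hS0, (tendsto_order.1 hauto).2 ((b' + β) / 20) (by linarith)]
        with t i1 i2 hle hle'
      have j0 : S t ^ 2 ≤ 9 / 10 := by nlinarith
      have j1 : 1 / 10 ≤ a * (1 - S t ^ 2) := by nlinarith
      have j2 := mul_le_mul j1 (by linarith : b' + β ≤ S t + β) (by linarith) (by linarith)
      linarith
    filter_upwards [this] with t ht
    linarith

end

/-- If `Σ₊` approaches `v H`, where `q < H Σ₊` for `Ω = 1 - Σ₊²`, then `H² - 1` decays. -/
theorem eventually_log_le_of_tendsto {a v : ℝ} (h : IsOrbit w κ H S M (Ici 0))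
    (hwa : w = (3 - 2 * a) / 3) (ha0 : 0 < a) (ha2 : a < 2) (hv0 : 0 < v) (hav : a * v < 1)
    (hV : (2 - a) - v * (1 - a * v) < 0) {B : ℝ} (hB : ∀ t ∈ Ici (0 : ℝ), H t ≤ B)
    (hd : Tendsto (fun t => S t - v * H t) atTop (𝓝 0)) (b : ℝ) :
    ∀ᶠ t in atTop, Real.log (H t ^ 2 - 1) ≤ b := by
  have hsmall : Tendsto (fun t => B * |S t - v * H t| + 2 * (S t - v * H t) ^ 2)
      atTop (𝓝 0) := by
    simpa using (hd.abs.const_mul B).add ((hd.pow 2).const_mul 2)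
  set V := (2 - a) - v * (1 - a * v) with hVdef
  refine eventually_le_of_deriv_le (fun t ht => h.hasDerivWithinAt_log_sq_sub_one ht)
    (c := -V) (by linarith) ?_
  filter_upwards [eventually_ge_atTop (0 : ℝ), (tendsto_order.1 hsmall).2 (-V / 2) (by linarith)]
    with t ht i1 _
  have i2 := h.one_lt t ht
  have i3 := hB t ht
  have j1 : dec w (S t) (M t) ≤ (2 - a) + a * S t ^ 2 := by
    have := mul_le_mul_of_nonneg_left (om_le (S := S t) (M := M t)) (by linarith : 0 ≤ 2 - a)
    unfold dec
    rw [hwa]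
    linarith
  have j2 : (2 - a) + a * S t ^ 2 - H t * S t = (2 - a) - v * (1 - a * v) * H t ^ 2
      + (2 * (a * v) - 1) * H t * (S t - v * H t) + a * (S t - v * H t) ^ 2 := by ring
  have j3 : (2 - a) - v * (1 - a * v) * H t ^ 2 ≤ V := by
    have : 0 ≤ v * (1 - a * v) * (H t ^ 2 - 1) :=
      mul_nonneg (mul_nonneg hv0.le (by linarith)) (h.sq_sub_one_pos ht).le
    linarith
  have j4 : (2 * (a * v) - 1) * H t * (S t - v * H t) ≤ B * |S t - v * H t| := by
    refine (le_abs_self _).trans ?_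
    rw [abs_mul, abs_mul, abs_of_pos (by linarith : 0 < H t)]
    refine mul_le_mul_of_nonneg_right ?_ (abs_nonneg _)
    have k1 : 0 < a * v := mul_pos ha0 hv0
    have k2 : |2 * (a * v) - 1| ≤ 1 := abs_le.2 ⟨by linarith, by linarith⟩
    exact (mul_le_of_le_one_left (by linarith) k2).trans i3
  have j5 : a * (S t - v * H t) ^ 2 ≤ 2 * (S t - v * H t) ^ 2 :=
    mul_le_mul_of_nonneg_right ha2.le (sq_nonneg _)
  have j6 : dec w (S t) (M t) - H t * S t ≤ V / 2 := by linarith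
  have j7 := mul_le_mul_of_nonneg_left j6 (by linarith : 0 ≤ 2 * H t)
  have j8 := mul_le_mul_of_nonpos_right i2.le hV.le
  linarith

/-- With anisotropic matter in the `⊃`-shaped region, `H → 1` and `Σ₊ → -β`. Here
`a = 3 (1 - w) / 2` and `hreg` is the inequality `q < H Σ₊` at the limit point. The monotone
function is a product of powers as for a perfect fluid, but now the exponent of `H² - 1` is
negative. -/
theorem tendsto_of_anisotropic {a β : ℝ} (h : IsOrbit w κ H S M (Ici 0))
    (hO : ∀ t ∈ Ici (0 : ℝ), 0 < om (S t) (M t)) (hwa : w = (3 - 2 * a) / 3)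
    (ha1 : 1 < a) (ha2 : a < 2) (hβ2 : -1 / 2 < β) (hreg : 2 - a + β + a * β ^ 2 < 0)
    {c C : ℝ} (hc : 0 < c) (hC : 0 ≤ C)
    (hη : ∀ t ∈ Ici (0 : ℝ), |κ t + a * β / 3| ≤ C * Real.exp (-c * t)) :
    (∃ B, ∀ t ∈ Ici (0 : ℝ), H t ≤ B) ∧ Tendsto H atTop (𝓝 1) ∧ Tendsto S atTop (𝓝 (-β)) := by
  have hw : -1 / 3 < w := by linarith
  have hw1 : w < 1 := by linarith
  have hβ : β < 0 := by nlinarith [sq_nonneg β]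
  have hexp : ∀ t ∈ Ici (0 : ℝ), Real.exp (-c * t) ≤ 1 := fun t ht =>
    Real.exp_le_one_iff.2 (by nlinarith [mem_Ici.1 ht])
  have hη0 : Tendsto (fun t => κ t + a * β / 3) atTop (𝓝 0) := by
    refine squeeze_zero_norm' ?_ (tendsto_const_mul_exp_neg C hc)
    filter_upwards [eventually_ge_atTop (0 : ℝ)] with t ht using hη t ht
  have hκ : ∀ t ∈ Ici (0 : ℝ), |κ t| ≤ C + |a * β / 3| := fun t ht => by
    have e : κ t = (κ t + a * β / 3) - a * β / 3 := by ring
    rw [e]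
    refine (abs_sub _ _).trans (add_le_add ((hη t ht).trans ?_) le_rfl)
    exact mul_le_of_le_one_right hC (hexp t ht)
  have hS0 := h.eventually_neg_half_le_S hwa ha1 ha2 hβ hβ2 hη0
  obtain ⟨B, hB⟩ := h.exists_H_le hw1 (by linarith) hS0
  have hB1 : 1 < B := (h.one_lt 0 self_mem_Ici).trans_le (hB 0 self_mem_Ici)
  obtain ⟨v, γ, hv0, hvβ, hap, hU, hγ, hg2⟩ := exists_exponents ha2 hβ hβ2 hreg (by linarith)
  have hγ1 : 1 < γ := by nlinarith
  have he : ∀ t ∈ Ici (0 : ℝ), 1 / 2 ≤ H t - v * S t ∧ H t - v * S t ≤ B + 1 := fun t ht => by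
    constructor <;> nlinarith [h.one_lt t ht, h.neg_one_lt t ht, h.lt_one t ht, hB t ht]
  have he0 : ∀ t ∈ Ici (0 : ℝ), 0 < H t - v * S t := fun t ht => by linarith [(he t ht).1]
  -- the exponential compensates for the dependence of the matter model on `s`
  have hL : ∀ t ∈ Ici (0 : ℝ), HasDerivWithinAt
      (fun t => -Real.log (H t ^ 2 - 1) + γ * Real.log (om (S t) (M t))
        - 2 * (γ - 1) * Real.log (H t - v * S t) - 18 * γ * C / c * Real.exp (-c * t))
      (2 * ((γ * a - 2) * (S t - v * H t) ^ 2 + (γ - 1) * (v * M t ^ 2 / 4)) / (H t - v * S t)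
        + (6 * (γ - 1) * v * om (S t) (M t) / (H t - v * S t) - 6 * γ * S t)
          * (κ t + a * β / 3) + 18 * γ * C * Real.exp (-c * t))
      (Ici 0) t := fun t ht => by
    have hexp' : HasDerivWithinAt (fun t => Real.exp (-c * t)) (Real.exp (-c * t) * -c)
        (Ici 0) t := by
      simpa using ((hasDerivAt_id t).const_mul (-c)).exp.hasDerivWithinAt
    refine ((((h.hasDerivWithinAt_log_sq_sub_one ht).fun_neg.add
      ((h.hasDerivWithinAt_log_om ht (hO t ht)).const_mul γ)).sub
      ((h.hasDerivWithinAt_log_sub ht (he0 t ht)).const_mul (2 * (γ - 1)))).sub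
      (hexp'.const_mul (18 * γ * C / c))).congr_deriv ?_
    rw [← anisotropic_rate_eq hap hγ (he0 t ht).ne', ← hwa]
    have e : -(a * β) / 3 + (κ t + a * β / 3) = κ t := by ring
    rw [e]
    field_simp
    ring
  set c₂ := 2 * (γ * a - 2) / (B + 1) with hc₂
  have hc₂0 : 0 < c₂ := by positivity
  have hL' : ∀ t ∈ Ici (0 : ℝ), c₂ * (S t - v * H t) ^ 2 ≤
      2 * ((γ * a - 2) * (S t - v * H t) ^ 2 + (γ - 1) * (v * M t ^ 2 / 4)) / (H t - v * S t)
        + (6 * (γ - 1) * v * om (S t) (M t) / (H t - v * S t) - 6 * γ * S t)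
          * (κ t + a * β / 3) + 18 * γ * C * Real.exp (-c * t) := fun t ht => by
    have := anisotropic_rate_ge (M := M t) hv0 (by linarith) hγ1 hg2 (hO t ht) (h.abs_S_le ht)
      (he t ht).1 (he t ht).2 (hη t ht)
    rwa [← mul_assoc] at this
  -- if the monotone function is bounded, then `S - v H → 0`, and `H² - 1` decays; otherwise it is
  -- unbounded because of the negative power of `H² - 1`, the only unbounded factor
  have hk : ∀ b, ∀ᶠ t in atTop, Real.log (H t ^ 2 - 1) ≤ b := by
    by_cases hbd : ∃ B', ∀ t ∈ Ici (0 : ℝ), -Real.log (H t ^ 2 - 1)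
        + γ * Real.log (om (S t) (M t)) - 2 * (γ - 1) * Real.log (H t - v * S t)
        - 18 * γ * C / c * Real.exp (-c * t) ≤ B'
    · obtain ⟨B', hB'⟩ := hbd
      have hφ : Tendsto (fun t => c₂ * (S t - v * H t) ^ 2) atTop (𝓝 0) :=
        tendsto_zero_of_le_deriv hL (h.uniformContinuousOn_comp hw hw1 hκ hB
          (g := fun x => c₂ * (x.2.1 - v * x.1) ^ 2) (by fun_prop))
          (fun t _ => by positivity) hL' hB'
      have hd : Tendsto (fun t => S t - v * H t) atTop (𝓝 0) :=
        tendsto_zero_of_const_mul_sq hc₂0.ne' hφ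
      have hav : a * v < 1 := by nlinarith
      have hV : v * (v * a + a * β) < 0 := mul_neg_of_pos_of_neg hv0 hU
      exact h.eventually_log_le_of_tendsto hwa (by linarith) ha2 hv0 hav (by nlinarith) hB hd
    · push Not at hbd
      intro b
      obtain ⟨T, hT0, hT⟩ := hbd (-b + 2 * (γ - 1) * Real.log 2)
      filter_upwards [eventually_ge_atTop T] with t ht
      have ht0 : 0 ≤ t := le_trans hT0 ht
      have h1 := mul_sub_le_sub_of_le_derivWithin hL ht (Icc_subset_Ici_zero hT0) (c := 0)
        fun u hu => (by positivity : 0 ≤ c₂ * (S u - v * H u) ^ 2).trans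
          (hL' u (le_trans hT0 hu.1))
      have i2 : Real.log (om (S t) (M t)) ≤ 0 :=
        Real.log_nonpos (hO t ht0).le (om_le.trans (by nlinarith [sq_nonneg (S t)]))
      have i3 := Real.log_le_log (by norm_num) (he t ht0).1
      rw [one_div, Real.log_inv] at i3
      have i4 := mul_le_mul_of_nonneg_left i2 (by linarith : 0 ≤ γ)
      have i5 := mul_le_mul_of_nonneg_left i3 (by linarith : 0 ≤ 2 * (γ - 1))
      have i6 : 0 ≤ 18 * γ * C / c * Real.exp (-c * t) := by positivity
      linarith
  have hlog : Tendsto (fun t => Real.log (H t ^ 2 - 1)) atTop atBot := tendsto_atBot.2 hk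
  have hk0 : Tendsto (fun t => H t ^ 2 - 1) atTop (𝓝 0) := by
    refine (Real.tendsto_exp_atBot.comp hlog).congr' ?_
    filter_upwards [eventually_ge_atTop (0 : ℝ)] with t ht
    exact Real.exp_log (h.sq_sub_one_pos ht)
  have hH : Tendsto H atTop (𝓝 1) := by
    have h1 := (hk0.add_const 1).sqrt
    rw [zero_add, Real.sqrt_one] at h1
    refine h1.congr' ?_
    filter_upwards [eventually_ge_atTop (0 : ℝ)] with t ht
    rw [sub_add_cancel, Real.sqrt_sq (by linarith [h.one_lt t ht])]
  exact ⟨⟨B, hB⟩, hH, h.tendsto_S_of_tendsto_H hwa ha1 ha2 hβ hβ2 hη0 hB hκ hk hH⟩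

end IsOrbit

/-! ### The parameter region -/

/-- In terms of `a = 3 (1 - w) / 2`, the curves `β±` are the roots of `a β² + β + 2 - a`. -/
theorem bounds_of_mem_paramSup {w β : ℝ} (h : (w, β) ∈ paramSup) :
    1 < 3 * (1 - w) / 2 ∧ 3 * (1 - w) / 2 < 2 ∧ -1 / 2 < β ∧
      2 - 3 * (1 - w) / 2 + β + 3 * (1 - w) / 2 * β ^ 2 < 0 := by
  obtain ⟨⟨hw, -⟩, hlt, hm, hp⟩ := h
  simp only at hw hlt hm hp
  have h3 : (1 : ℝ) < √3 := Real.lt_sqrt_of_sq_lt (by norm_num)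
  have hw0 : w < 0 := by linarith
  unfold betaMinus at hm
  unfold betaPlus at hp
  have ha : 0 < 3 * (1 - w) := by linarith
  rw [div_lt_iff₀ ha] at hm
  rw [lt_div_iff₀ ha] at hp
  have h0 : 0 < √(-3 + (1 - 3 * w) ^ 2) := by linarith
  have hsq := Real.sq_sqrt (Real.sqrt_pos.1 h0).le
  have hq : 2 - 3 * (1 - w) / 2 + β + 3 * (1 - w) / 2 * β ^ 2 < 0 := by
    have h2 : (β * (3 * (1 - w)) + 1) ^ 2 < √(-3 + (1 - 3 * w) ^ 2) ^ 2 :=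
      sq_lt_sq' (by linarith) (by linarith)
    rw [hsq] at h2
    by_contra hcon
    nlinarith [mul_nonneg ha.le (not_lt.1 hcon)]
  refine ⟨by linarith, by linarith, ?_, hq⟩
  -- at `β = -1 / 2` the quadratic is positive, and the vertex lies to the right of it
  by_contra hcon
  nlinarith [mul_nonneg (by linarith : 0 ≤ -1 / 2 - β)
    (by nlinarith : 0 ≤ -(1 + 3 * (1 - w) / 2 * (β - 1 / 2)))]

theorem paramSup_nonempty : paramSup.Nonempty := by
  -- the midpoint of `β₋` and `β₊` at `w = -3 / 10`
  refine ⟨(-3 / 10, -10 / 39), ⟨?_, ?_⟩, ?_, ?_, ?_⟩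
  · norm_num
  · norm_num
  · have : √3 < 19 / 10 := (Real.sqrt_lt' (by norm_num)).2 (by norm_num)
    simp only
    linarith
  · have : 0 < √(-3 + (1 - 3 * (-3 / 10 : ℝ)) ^ 2) := Real.sqrt_pos.2 (by norm_num)
    simp only [betaMinus]
    rw [div_lt_iff₀ (by norm_num)]
    linarith
  · have : 0 < √(-3 + (1 - 3 * (-3 / 10 : ℝ)) ^ 2) := Real.sqrt_pos.2 (by norm_num)
    simp only [betaPlus]
    rw [lt_div_iff₀ (by norm_num)]
    linarith

/-- An affine pressure function realises any pair of parameters. -/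
theorem exists_isMatterModel {w β : ℝ} (h : (w, β) ∈ paramSpace) : ∃ w₂, IsMatterModel w β w₂ := by
  have hw : 1 - w ≠ 0 := by linarith [h.2]
  refine ⟨fun s => w - β * (1 - w) / 2 + 3 * β * (1 - w) / 2 * s, h, by fun_prop, ?_, ?_⟩
  · simp only [w₁]
    ring
  · field_simp
    ring

/-- Near `s = 0` the matter behaves like one with the constant pressure `w₂ 0`, up to an error
linear in `s`. -/
theorem IsMatterModel.exists_abs_sub_le_mul {w β : ℝ} {w₂ : ℝ → ℝ} (h : IsMatterModel w β w₂) :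
    ∃ L : ℝ, 0 ≤ L ∧ ∀ s ∈ Icc (0 : ℝ) (1 / 2),
      |w₂ s - w + 3 * (1 - w) / 2 * β / 3| ≤ L * s := by
  obtain ⟨L, hL⟩ := h.regular.exists_lipschitzOnWith one_ne_zero (convex_Icc 0 (1 / 2))
    isCompact_Icc
  refine ⟨L, L.2, fun s hs => ?_⟩
  have h0 : w₂ 0 = w - 3 * (1 - w) / 2 * β / 3 := by
    have hw : 1 - w ≠ 0 := by linarith [h.mem_paramSpace.2]
    have := h.anisotropy
    field_simp at this
    linarith
  have := hL.dist_le_mul s hs 0 ⟨le_rfl, by norm_num⟩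
  rw [Real.dist_eq, Real.dist_eq, sub_zero, abs_of_nonneg hs.1, h0] at this
  rwa [sub_add]

/-! ### Limits of solutions -/

section Solutions

variable {w : ℝ} {w₂ : ℝ → ℝ} {γ : ℝ → YCoord} {y : YCoord}

theorem IsSolution.isOrbit (h : IsSolution w w₂ stateSpace y γ) :
    IsOrbit w (fun t => w₂ (sOf (toX (γ t))) - w) (fun t => (toX (γ t)).1)
      (fun t => (toX (γ t)).2.1) (fun t => (toX (γ t)).2.2) (Ici 0) :=
  isOrbit_of_isIntegralCurveOn h.ode
    (fun t ht => toX_mem_region (mem_stateSpace_iff.1 (h.mem t ht)).1)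
    (fun t ht => (mem_stateSpace_iff.1 (h.mem t ht)).2.le)

/-- Since `Ω = 0`, a vacuum solution solves the equations of a perfect fluid with `w = 0`. -/
theorem IsSolution.isOrbit_vacuum (h : IsSolution w w₂ vacuumSpace y γ) :
    IsOrbit 0 (fun t => perfectFluid 0 (sOf (toX (γ t))) - 0) (fun t => (toX (γ t)).1)
      (fun t => (toX (γ t)).2.1) (fun t => (toX (γ t)).2.2) (Ici 0) :=
  isOrbit_of_isIntegralCurveOn
    (fun t ht => (h.ode t ht).congr_deriv
      (field_eq_of_om_eq_zero w w₂ (mem_vacuumSpace_iff.1 (h.mem t ht)).2))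
    (fun t ht => toX_mem_region (mem_vacuumSpace_iff.1 (h.mem t ht)).1)
    (fun t ht => (mem_vacuumSpace_iff.1 (h.mem t ht)).2.ge)

/-- It suffices to determine the limits of `H_D` and `Σ₊`, since `M₁` and `M₁² / (H_D² - 1)` tend
to zero in any case. -/
theorem IsOrbit.tendsto_of_tendsto {κ : ℝ → ℝ} {K : ℝ}
    (h : IsOrbit w κ (fun t => (toX (γ t)).1) (fun t => (toX (γ t)).2.1)
      (fun t => (toX (γ t)).2.2) (Ici 0))
    (hγ : ∀ t ∈ Ici (0 : ℝ), γ t ∈ blownRegion) (hw : -1 / 3 < w) (hw1 : w < 1)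
    (hκ : ∀ t ∈ Ici (0 : ℝ), |κ t| ≤ K) {H S : ℝ}
    (hlim : (∃ B, ∀ t ∈ Ici (0 : ℝ), (toX (γ t)).1 ≤ B) ∧
      Tendsto (fun t => (toX (γ t)).1) atTop (𝓝 H) ∧
      Tendsto (fun t => (toX (γ t)).2.1) atTop (𝓝 S)) :
    Tendsto γ atTop (𝓝 (typeIIIPoint H S)) := by
  obtain ⟨⟨B, hB⟩, hH, hS⟩ := hlim
  refine tendsto_typeIIIPoint hγ (ge_of_tendsto hH ?_) hH hS (h.tendsto_M_sq hw hw1 hκ hB)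
    (h.tendsto_sq_div hw hw1 hκ)
  filter_upwards [eventually_ge_atTop (0 : ℝ)] with t ht using (h.one_lt t ht).le

end Solutions

theorem futureAsymptotic_vacuum (w : ℝ) (w₂ : ℝ → ℝ) {y : YCoord} (hy : y ∈ vacuumSpace) :
    FutureAsymptotic w w₂ vacuumSpace y D := by
  refine ⟨exists_isSolution_vacuumSpace w w₂ hy, fun γ h => ?_⟩
  have hκ : ∀ t ∈ Ici (0 : ℝ), perfectFluid 0 (sOf (toX (γ t))) - 0 = 0 := fun _ _ => sub_self _
  exact h.isOrbit_vacuum.tendsto_of_tendsto (fun t ht => (mem_vacuumSpace_iff.1 (h.mem t ht)).1)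
    (by norm_num) one_pos (K := 0) (fun t ht => by rw [hκ t ht, abs_zero])
    (h.isOrbit_vacuum.tendsto_of_nonneg le_rfl one_pos hκ)

theorem futureAsymptotic_perfectFluid_of_neg {w : ℝ} (hw : -1 / 3 < w) (hw0 : w < 0) {y : YCoord}
    (hy : y ∈ stateSpace) : FutureAsymptotic w (perfectFluid w) stateSpace y (P w 0) := by
  have hw1 : w < 1 := by linarith
  refine ⟨exists_isSolution_stateSpace hw hw1 contDiffOn_const hy, fun γ h => ?_⟩
  have hκ : ∀ t ∈ Ici (0 : ℝ), perfectFluid w (sOf (toX (γ t))) - w = 0 := fun _ _ => sub_self _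
  have hP : P w 0 = typeIIIPoint (1 / (1 - (1 + 3 * w) / 2))
      ((1 + 3 * w) / 2 * (1 / (1 - (1 + 3 * w) / 2))) := by
    have h1 : 1 - 3 * w ≠ 0 := by linarith
    have h2 : 1 - (1 + 3 * w) / 2 = (1 - 3 * w) / 2 := by ring
    rw [P, mul_zero, zero_mul, add_zero, mul_zero, zero_mul, add_zero,
      Real.sqrt_sq (by linarith), h2]
    congr 1
    · field_simp
    · field_simp
  rw [hP]
  exact h.isOrbit.tendsto_of_tendsto (fun t ht => (mem_stateSpace_iff.1 (h.mem t ht)).1)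
    hw hw1 (K := 0) (fun t ht => by rw [hκ t ht, abs_zero])
    (h.isOrbit.tendsto_of_neg hw hw0 hκ fun t ht => (mem_stateSpace_iff.1 (h.mem t ht)).2)

theorem futureAsymptotic_perfectFluid_of_nonneg {w : ℝ} (hw : 0 ≤ w) (hw1 : w < 1) {y : YCoord}
    (hy : y ∈ stateSpace) : FutureAsymptotic w (perfectFluid w) stateSpace y D := by
  have hw3 : -1 / 3 < w := by linarith
  refine ⟨exists_isSolution_stateSpace hw3 hw1 contDiffOn_const hy, fun γ h => ?_⟩
  have hκ : ∀ t ∈ Ici (0 : ℝ), perfectFluid w (sOf (toX (γ t))) - w = 0 := fun _ _ => sub_self _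
  exact h.isOrbit.tendsto_of_tendsto (fun t ht => (mem_stateSpace_iff.1 (h.mem t ht)).1)
    hw3 hw1 (K := 0) (fun t ht => by rw [hκ t ht, abs_zero])
    (h.isOrbit.tendsto_of_nonneg hw hw1 hκ)

theorem futureAsymptotic_Rflat {w β : ℝ} {w₂ : ℝ → ℝ} (hp : (w, β) ∈ paramSup)
    (hm : IsMatterModel w β w₂) {y : YCoord} (hy : y ∈ stateSpace) :
    FutureAsymptotic w w₂ stateSpace y (Rflat β) := by
  obtain ⟨ha1, ha2, hβ, hreg⟩ := bounds_of_mem_paramSup hp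
  obtain ⟨hw, hw1⟩ := hm.mem_paramSpace
  simp only at hw hw1
  refine ⟨exists_isSolution_stateSpace hw hw1 hm.regular hy, fun γ h => ?_⟩
  have hr : ∀ t ∈ Ici (0 : ℝ), toX (γ t) ∈ region := fun t ht =>
    toX_mem_region (mem_stateSpace_iff.1 (h.mem t ht)).1
  obtain ⟨K, -, hK⟩ := exists_abs_sub_le (w := w) hm.regular
  have hκ : ∀ t ∈ Ici (0 : ℝ), |w₂ (sOf (toX (γ t))) - w| ≤ K := fun t ht => hK _ (hr t ht)
  obtain ⟨c, C, hc, hC, hle⟩ := h.isOrbit.exists_sq_div_le hw hw1 hκ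
  obtain ⟨L, hL0, hL⟩ := hm.exists_abs_sub_le_mul
  refine h.isOrbit.tendsto_of_tendsto (fun t ht => (mem_stateSpace_iff.1 (h.mem t ht)).1)
    hw hw1 hκ (h.isOrbit.tendsto_of_anisotropic
      (fun t ht => (mem_stateSpace_iff.1 (h.mem t ht)).2) (by ring) ha1 ha2 hβ hreg hc
      (mul_nonneg hL0 hC.le) fun t ht => ?_)
  obtain ⟨hs0, hs1, hs2⟩ := sOf_mem (hr t ht)
  rw [mul_assoc]
  exact (hL _ ⟨hs0.le, hs1.le⟩).trans (mul_le_mul_of_nonneg_left (hs2.trans (hle t ht)) hL0)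

/-! ### Comparison of the limit points -/

theorem Rflat_ne_typeIIIPoint {β H S : ℝ} (hH : H ^ 2 ≠ 1) : Rflat β ≠ typeIIIPoint H S := by
  intro h
  have h1 := congrArg Prod.fst h
  simp only [Rflat, typeIIIPoint] at h1
  exact hH (by linarith)

theorem Rflat_ne_D {β : ℝ} : Rflat β ≠ D := Rflat_ne_typeIIIPoint (by norm_num)

theorem Rflat_ne_P {w β : ℝ} (β' : ℝ)
    (h : (2 + 3 * β' * (1 - w)) ^ 2 ≠ (1 - 3 * w) ^ 2 + 6 * β' * (1 - w)) :
    Rflat β ≠ P w β' := by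
  refine Rflat_ne_typeIIIPoint fun hH => ?_
  rw [div_pow] at hH
  rcases le_or_gt ((1 - 3 * w) ^ 2 + 6 * β' * (1 - w)) 0 with h0 | h0
  -- for a nonpositive radicand the quotient is zero by convention
  · simp [Real.sqrt_eq_zero_of_nonpos h0] at hH
  · rw [Real.sq_sqrt h0.le, div_eq_one_iff_eq h0.ne'] at hH
    exact h hH

/-- Since the solution exists, the limit point is unique. -/
theorem FutureAsymptotic.not_of_ne {w : ℝ} {w₂ : ℝ → ℝ} {𝒮 : Set YCoord} {y p p' : YCoord}
    (h : FutureAsymptotic w w₂ 𝒮 y p) (hp : p ≠ p') : ¬ FutureAsymptotic w w₂ 𝒮 y p' := by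
  intro h'
  obtain ⟨γ, hγ⟩ := h.1
  exact hp (tendsto_nhds_unique (h.2 γ hγ) (h'.2 γ hγ))

end LRSVIII

open LRSVIII in
theorem mainTheorem4 :
    -- vacuum solutions are future asymptotic to `D` (there `w`, `w₂` drop out of the equations)
    (∀ (w : ℝ) (w₂ : ℝ → ℝ), ∀ y ∈ vacuumSpace, FutureAsymptotic w w₂ vacuumSpace y D) ∧
    -- generic perfect fluid solutions are future asymptotic to `P` or to `D`
    (∀ w : ℝ, -1 / 3 < w → w < 0 → Generically fun y =>
      FutureAsymptotic w (perfectFluid w) stateSpace y (P w 0)) ∧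
    (∀ w : ℝ, 0 ≤ w → w < 1 → Generically fun y =>
      FutureAsymptotic w (perfectFluid w) stateSpace y D) ∧
    -- the region is not empty, and each of its points is realised by a matter model
    paramSup.Nonempty ∧
    (∀ w β : ℝ, (w, β) ∈ paramSup → ∃ w₂ : ℝ → ℝ, IsMatterModel w β w₂) ∧
    -- there generic solutions are future asymptotic to `R♭`, and neither to `D` nor to `P`
    (∀ (w β : ℝ) (w₂ : ℝ → ℝ), (w, β) ∈ paramSup → IsMatterModel w β w₂ →
      Generically fun y =>
        FutureAsymptotic w w₂ stateSpace y (Rflat β) ∧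
        ¬ FutureAsymptotic w w₂ stateSpace y D ∧
        ¬ FutureAsymptotic w w₂ stateSpace y (P w β) ∧
        ¬ FutureAsymptotic w w₂ stateSpace y (P w 0)) := by
  refine ⟨fun w w₂ y hy => futureAsymptotic_vacuum w w₂ hy,
    fun w hw hw0 => generically_of_forall fun y hy =>
      futureAsymptotic_perfectFluid_of_neg hw hw0 hy,
    fun w hw hw1 => generically_of_forall fun y hy =>
      futureAsymptotic_perfectFluid_of_nonneg hw hw1 hy,
    paramSup_nonempty, fun w β h => exists_isMatterModel h.1,
    fun w β w₂ hp hm => generically_of_forall fun y hy => ?_⟩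
  have h := futureAsymptotic_Rflat hp hm hy
  obtain ⟨ha1, ha2, -, hreg⟩ := bounds_of_mem_paramSup hp
  refine ⟨h, h.not_of_ne Rflat_ne_D, h.not_of_ne (Rflat_ne_P β ?_), h.not_of_ne (Rflat_ne_P 0 ?_)⟩
  · nlinarith
  · nlinarith
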